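/- \textbf{Setting.} Let $H$ be a complex Hilbert space, $B(H)$ its algebra of bounded operators, and $X_1,X_2\in B(H)$ (not assumed self-adjoint) with spectral decompositions $$X_j=\int_{\sigma(X_j)}\lambda\,dE_j(\lambda)+\int_{\sigma(X_j)}(X_j-\lambda I)\,dE_j(\lambda),\qquad j=1,2 .$$ Here $E_j$ is a (strongly) countably additive Borel measure on $\mathbb C$ whose values are (not necessarily orthogonal) projections in $B(H)$ commuting with $X_j$, with $E_j(A\cap B)=E_j(A)E_j(B)$ and $E_j(\sigma(X_j))=I$, and $(X_j-\lambda I)\,dE_j(\lambda)$ is nilpotent of order $m_j(\lambda)$: $m_j:\mathbb C\to\mathbb N$ is Borel, bounded on $\sigma(X_j)$, and for every $\ell\ge 0$ $$\int_{\{\lambda\in\sigma(X_j):\,m_j(\lambda)\le\ell\}}(X_j-\lambda I)^\ell\,dE_j(\lambda)=0 .$$ All integrals are limits in operator norm of Riemann sums over tagged finite Borel partitions, directed by refinement; for double integrals, independent partitions of $\sigma(X_1)$ and $\sigma(X_2)$ are used. Let $D\subseteq\mathbb C^2$ be open with $\sigma(X_1)\times\sigma(X_2)\subseteq D$. For $\beta:\mathbb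 C^2\to\mathbb C$ analytic on $D$ and $Y\in B(H)$, put $\beta^{(p,q)}=\partial_1^p\partial_2^q\beta$ and $$\begin{aligned}T_\beta^{X_1,X_2}(Y)={}&\int_{\sigma(X_1)}\int_{\sigma(X_2)}\beta(\lambda_1,\lambda_2)\,dE_1(\lambda_1)\,Y\,dE_2(\lambda_2)\\&+\int_{\sigma(X_1)}\int_{\sigma(X_2)}\sum_{q_2=1}^{m_2(\lambda_2)-1}\frac{\beta^{(0,q_2)}(\lambda_1,\lambda_2)}{q_2!}\,dE_1(\lambda_1)\,Y\,(X_2-\lambda_2I)^{q_2}dE_2(\lambda_2)\\&+\int_{\sigma(X_1)}\int_{\sigma(X_2)}\sum_{q_1=1}^{m_1(\lambda_1)-1}\frac{\beta^{(q_1,0)}(\lambda_1,\lambda_2)}{q_1!}\,(X_1-\lambda_1I)^{q_1}dE_1(\lambda_1)\,Y\,dE_2(\lambda_2)\\&+\int_{\sigma(X_1)}\int_{\sigma(X_2)}\sum_{q_1=1}^{m_1(\lambda_1)-1}\sum_{q_2=1}^{m_2(\lambda_2)-1}\frac{\beta^{(q_1,q_2)}(\lambda_1,\lambda_2)}{q_1!\,q_2!}\,(X_1-\lambda_1I)^{q_1}dE_1(\lambda_1)\,Y\,(X_2-\lambda_2I)^{q_2}dE_2(\lambda_2).\end{aligned}$$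 \textbf{Lemma.} For every $\beta$ analytic on $D$ and every $Y\in B(H)$ the four double integrals exist, and $\beta\mapsto T_\beta^{X_1,X_2}$ is a linear homomorphism: for all $c_1,c_2\in\mathbb C$ and all $\beta_1,\beta_2,\beta,\gamma$ analytic on $D$, $$T^{X_1,X_2}_{c_1\beta_1+c_2\beta_2}=c_1T^{X_1,X_2}_{\beta_1}+c_2T^{X_1,X_2}_{\beta_2},\qquad T^{X_1,X_2}_{\beta\gamma}=T^{X_1,X_2}_\beta\circ T^{X_1,X_2}_\gamma .$$ -/

import Mathlib

open Filter Topology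

noncomputable section

namespace GDOI

/-- Borel subsets of the complex plane. -/
abbrev BorelSet : Type := {A : Set ℂ // MeasurableSet A}

/-- A finite partition of the Borel set `S` into non-empty Borel cells, with a tag chosen
in every cell. (Only the values of `tag` on the cells matter.) -/
structure TaggedPartition (S : BorelSet) where
  /-- the underlying finite Borel partition -/
  cells : Finpartition S
  /-- the tag of a cell -/
  tag : BorelSet → ℂ
  tag_mem : ∀ Δ ∈ cells.parts, tag Δ ∈ Δ.1

/-- The filter of successive refinement: a property holds eventually if it holds for all
tagged partitions refining some finite Borel partition. -/
def refinement (S : BorelSet) : Filter (TaggedPartition S) :=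
  ⨅ π : Finpartition S, 𝓟 {τ | τ.cells ≤ π}

theorem exists_tagged {S : BorelSet} (π : Finpartition S) :
    ∃ τ : TaggedPartition S, τ.cells = π := by
  have h : ∀ Δ : BorelSet, ∃ z : ℂ, Δ ∈ π.parts → z ∈ Δ.1 := by
    intro Δ
    by_cases hΔ : Δ ∈ π.parts
    · have h1 : Δ.1.Nonempty := by
        rw [Set.nonempty_iff_ne_empty]
        intro h2
        exact π.ne_bot hΔ (Subtype.ext h2)
      exact ⟨h1.some, fun _ => h1.some_mem⟩
    · exact ⟨0, fun h' => absurd h' hΔ⟩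
  choose t ht using h
  exact ⟨⟨π, t, ht⟩, rfl⟩

/-- Limits along refinement are limits along a proper filter, hence unique. -/
instance refinement_neBot (S : BorelSet) : (refinement S).NeBot := by
  classical
  obtain ⟨τ₀, -⟩ := exists_tagged (⊤ : Finpartition S)
  have : Nonempty (TaggedPartition S) := ⟨τ₀⟩
  unfold refinement
  refine iInf_neBot_of_directed ?_ ?_
  · intro a b
    refine ⟨a ⊓ b, ?_, ?_⟩
    · exact principal_mono.2 fun τ (h : τ.cells ≤ a ⊓ b) => h.trans inf_le_left
    · exact principal_mono.2 fun τ (h : τ.cells ≤ a ⊓ b) => h.trans inf_le_right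
  · intro π
    obtain ⟨τ, hτ⟩ := exists_tagged π
    exact principal_neBot_iff.2 ⟨τ, hτ.le⟩

variable {H : Type*} [NormedAddCommGroup H] [InnerProductSpace ℂ H] [CompleteSpace H]

/-- `∫_{λ ∈ S} F(λ) dE(λ) = T`, for an operator-valued `F`: the Riemann sums
`∑_Δ F(s_Δ) E(Δ)` over tagged Borel partitions of `S` converge to `T` in operator norm
under refinement. -/
def HasIntegral (E : Set ℂ → H →L[ℂ] H) (S : BorelSet) (F : ℂ → H →L[ℂ] H)
    (T : H →L[ℂ] H) : Prop :=
  Tendsto (fun τ : TaggedPartition S => ∑ Δ ∈ τ.cells.parts, F (τ.tag Δ) * E Δ.1)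
    (refinement S) (𝓝 T)

/-- The spectrum of a bounded operator, as a Borel set. -/
def spec (X : H →L[ℂ] H) : BorelSet :=
  ⟨spectrum ℂ X, (spectrum.isClosed X).measurableSet⟩

/-- A spectral decomposition
`X = ∫_{σ(X)} λ dE(λ) + ∫_{σ(X)} (X - λ I) dE(λ)` of a bounded operator `X`:
a countably additive measure `E` with values in the (not necessarily orthogonal) projections
commuting with `X`, carried by the spectrum of `X`, such that `(X - λ I) dE(λ)` is nilpotent,
of order `m λ`, where `m` is bounded on the spectrum.
(The displayed identity then holds since `∫_{σ(X)} dE(λ) = I`.) -/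
structure SpectralDecomposition (X : H →L[ℂ] H) where
  /-- the spectral measure -/
  E : Set ℂ → H →L[ℂ] H
  /-- the order `m λ` of the nilpotent `(X - λ I) dE(λ)` -/
  m : ℂ → ℕ
  E_inter : ∀ A B : Set ℂ, MeasurableSet A → MeasurableSet B → E (A ∩ B) = E A * E B
  E_iUnion : ∀ A : ℕ → Set ℂ, (∀ n, MeasurableSet (A n)) →
    Pairwise (fun i j => Disjoint (A i) (A j)) → ∀ x : H,
    HasSum (fun n => E (A n) x) (E (⋃ n, A n) x)
  E_spectrum : E (spectrum ℂ X) = 1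
  E_commute : ∀ A : Set ℂ, MeasurableSet A → Commute X (E A)
  measurable_m : Measurable m
  m_bounded : ∃ M : ℕ, ∀ z ∈ spectrum ℂ X, m z ≤ M
  /-- `(X - λ I)^ℓ dE(λ) = 0` for `ℓ ≥ m λ`. -/
  nilpotent : ∀ ℓ : ℕ,
    HasIntegral E
      ⟨spectrum ℂ X ∩ {z | m z ≤ ℓ},
        (spectrum.isClosed X).measurableSet.inter (measurable_m measurableSet_Iic)⟩
      (fun z => (X - z • (1 : H →L[ℂ] H)) ^ ℓ) 0

/-- The Riemann sum `∑_{Δ₁, Δ₂} K(s_{Δ₁}, t_{Δ₂}, E₁(Δ₁), E₂(Δ₂))` of the double operator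
integral whose integrand is the expression `K(λ₁, λ₂, dE₁(λ₁), dE₂(λ₂))`. -/
def doubleSum (E₁ E₂ : Set ℂ → H →L[ℂ] H) (S₁ S₂ : BorelSet)
    (K : ℂ → ℂ → (H →L[ℂ] H) → (H →L[ℂ] H) → (H →L[ℂ] H))
    (τ : TaggedPartition S₁ × TaggedPartition S₂) : H →L[ℂ] H :=
  ∑ Δ₁ ∈ τ.1.cells.parts, ∑ Δ₂ ∈ τ.2.cells.parts,
    K (τ.1.tag Δ₁) (τ.2.tag Δ₂) (E₁ Δ₁.1) (E₂ Δ₂.1)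

/-- `∫_{λ₁ ∈ S₁} ∫_{λ₂ ∈ S₂} K(λ₁, λ₂, dE₁(λ₁), dE₂(λ₂)) = T`, as a limit of Riemann sums in
operator norm. -/
def HasDoubleIntegral (E₁ E₂ : Set ℂ → H →L[ℂ] H) (S₁ S₂ : BorelSet)
    (K : ℂ → ℂ → (H →L[ℂ] H) → (H →L[ℂ] H) → (H →L[ℂ] H)) (T : H →L[ℂ] H) : Prop :=
  Tendsto (doubleSum E₁ E₂ S₁ S₂ K) (refinement S₁ ×ˢ refinement S₂) (𝓝 T)

/-- The value of `∫_{λ₁ ∈ S₁} ∫_{λ₂ ∈ S₂} K(λ₁, λ₂, dE₁(λ₁), dE₂(λ₂))`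
(meaningful when the integral exists). -/
def doubleIntegral (E₁ E₂ : Set ℂ → H →L[ℂ] H) (S₁ S₂ : BorelSet)
    (K : ℂ → ℂ → (H →L[ℂ] H) → (H →L[ℂ] H) → (H →L[ℂ] H)) : H →L[ℂ] H :=
  limUnder (refinement S₁ ×ˢ refinement S₂) (doubleSum E₁ E₂ S₁ S₂ K)

/-- The partial derivative `β^{(q₁,q₂)}(z₁,z₂)`. -/
def pderiv (q₁ q₂ : ℕ) (β : ℂ × ℂ → ℂ) (z₁ z₂ : ℂ) : ℂ :=
  iteratedDeriv q₁ (fun w₁ => iteratedDeriv q₂ (fun w₂ => β (w₁, w₂)) z₂) z₁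

section Terms

variable {X₁ X₂ : H →L[ℂ] H} (R₁ : SpectralDecomposition X₁) (R₂ : SpectralDecomposition X₂)
  (β : ℂ × ℂ → ℂ) (Y : H →L[ℂ] H)

/-- `β(λ₁,λ₂) dE₁ Y dE₂` -/
def kernelPP (β : ℂ × ℂ → ℂ) (Y : H →L[ℂ] H) :
    ℂ → ℂ → (H →L[ℂ] H) → (H →L[ℂ] H) → (H →L[ℂ] H) :=
  fun s t P Q => β (s, t) • (P * Y * Q)

/-- `∑_{q₂=1}^{m_{λ₂}-1} (β^{(-,q₂)}(λ₁,λ₂) / q₂!) dE₁ Y (X₂ - λ₂ I)^{q₂} dE₂` -/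
def kernelPN : ℂ → ℂ → (H →L[ℂ] H) → (H →L[ℂ] H) → (H →L[ℂ] H) :=
  fun s t P Q => ∑ q₂ ∈ Finset.Icc 1 (R₂.m t - 1),
    (pderiv 0 q₂ β s t / (q₂.factorial : ℂ)) •
      (P * Y * ((X₂ - t • (1 : H →L[ℂ] H)) ^ q₂ * Q))

/-- `∑_{q₁=1}^{m_{λ₁}-1} (β^{(q₁,-)}(λ₁,λ₂) / q₁!) (X₁ - λ₁ I)^{q₁} dE₁ Y dE₂` -/
def kernelNP : ℂ → ℂ → (H →L[ℂ] H) → (H →L[ℂ] H) → (H →L[ℂ] H) :=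
  fun s t P Q => ∑ q₁ ∈ Finset.Icc 1 (R₁.m s - 1),
    (pderiv q₁ 0 β s t / (q₁.factorial : ℂ)) •
      ((X₁ - s • (1 : H →L[ℂ] H)) ^ q₁ * P * Y * Q)

/-- `∑_{q₁=1}^{m_{λ₁}-1} ∑_{q₂=1}^{m_{λ₂}-1} (β^{(q₁,q₂)}(λ₁,λ₂) / (q₁! q₂!))
(X₁ - λ₁ I)^{q₁} dE₁ Y (X₂ - λ₂ I)^{q₂} dE₂` -/
def kernelNN : ℂ → ℂ → (H →L[ℂ] H) → (H →L[ℂ] H) → (H →L[ℂ] H) :=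
  fun s t P Q => ∑ q₁ ∈ Finset.Icc 1 (R₁.m s - 1), ∑ q₂ ∈ Finset.Icc 1 (R₂.m t - 1),
    (pderiv q₁ q₂ β s t / ((q₁.factorial : ℂ) * (q₂.factorial : ℂ))) •
      ((X₁ - s • (1 : H →L[ℂ] H)) ^ q₁ * P * Y * ((X₂ - t • (1 : H →L[ℂ] H)) ^ q₂ * Q))

/-- Convergence of the four double integrals that make up the generalized double operator
integral of `β` at `Y`. -/
def Converges : Prop :=
  (∃ T, HasDoubleIntegral R₁.E R₂.E (spec X₁) (spec X₂) (kernelPP β Y) T) ∧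
  (∃ T, HasDoubleIntegral R₁.E R₂.E (spec X₁) (spec X₂) (kernelPN R₂ β Y) T) ∧
  (∃ T, HasDoubleIntegral R₁.E R₂.E (spec X₁) (spec X₂) (kernelNP R₁ β Y) T) ∧
  (∃ T, HasDoubleIntegral R₁.E R₂.E (spec X₁) (spec X₂) (kernelNN R₁ R₂ β Y) T)

/-- The generalized double operator integral `Y ↦ T_β^{X₁,X₂}(Y)`. -/
def gdoi : (H →L[ℂ] H) → (H →L[ℂ] H) := fun Y =>
  doubleIntegral R₁.E R₂.E (spec X₁) (spec X₂) (kernelPP β Y) +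
  doubleIntegral R₁.E R₂.E (spec X₁) (spec X₂) (kernelPN R₂ β Y) +
  doubleIntegral R₁.E R₂.E (spec X₁) (spec X₂) (kernelNP R₁ β Y) +
  doubleIntegral R₁.E R₂.E (spec X₁) (spec X₂) (kernelNN R₁ R₂ β Y)

end Terms

end GDOI

end

/-!
# The homomorphism property of generalized double operator integrals

Over a single pair of tagged partitions, the Riemann sums
`∑ φ(s, t) E₁(Δ₁) Y E₂(Δ₂)` are already multiplicative in `φ` (`dsum_dsum`), because the cells are
disjoint and `E(Δ) E(Δ') = E(Δ ∩ Δ')`. The identity passes to the limit as soon as the sums converge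
at every `Y` and are bounded uniformly in the partitions; such `φ` are called admissible.

Uniform bounds come from one measure at a time. The values of `E` are bounded by the
Banach–Steinhaus theorem, as `A ↦ E(A) x` is a vector measure, so `‖∑ f(s) E(Δ)‖ ≤ C sup |f|`
(`exists_norm_ssum_le`). For two measures this bounds tensor products `f ⊗ g`, and hence normally
convergent series of them. Continuity of `φ` alone would not suffice, but an analytic `φ` is locally
such a series, by its Taylor expansion; compactness of `σ(X₁) × σ(X₂)` and multiplication by
indicator functions make it admissible (`Admissible.of_analytic`).

The operator-valued factors `(X - λ)^a` are absorbed in the same way: `∑ (X - s)^a E(Δ)` is the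
`a`-th power of `∑ (X - s) E(Δ)`, and it converges to `N^a`, where `N = ∫ (X - λ) dE(λ)`. By
hypothesis the points with `m(λ) ≤ a` contribute nothing to it; thus `N` is nilpotent, and cutting
off the sums at `m(λ) - 1` does not change the limit (`exists_nilpotentPart`). Therefore
`T_β(Y) = ∑ (1 / (a! b!)) ∫∫ β^{(a,b)} dE₁ (N₁^a Y N₂^b) dE₂` with a fixed range of summation
(`gdoi_eq`). This expression is linear in `β`, and the Leibniz rule makes it multiplicative, since
the terms beyond the truncation vanish.
-/

open Filter Topology

namespace GDOI

/-- A complex combination of vectors all of whose partial sums are bounded by `K` is bounded by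
`4 K` times the largest coefficient: test against functionals, and split the real and the
imaginary parts of the values by their signs. -/
theorem norm_sum_smul_le_of_subset_sums {ι V : Type*} [NormedAddCommGroup V] [NormedSpace ℂ V]
    (s : Finset ι) (v : ι → V) (a : ι → ℂ) {K B : ℝ} (hB : 0 ≤ B)
    (hK : ∀ t ⊆ s, ‖∑ i ∈ t, v i‖ ≤ K) (ha : ∀ i ∈ s, ‖a i‖ ≤ B) :
    ‖∑ i ∈ s, a i • v i‖ ≤ 4 * K * B := by
  classical
  have hK0 : 0 ≤ K := (norm_nonneg _).trans (hK ∅ (Finset.empty_subset _))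
  refine NormedSpace.norm_le_dual_bound ℂ _ (by positivity) fun f => ?_
  have hre : ∀ r : ι → ℝ, (∀ t ⊆ s, |∑ i ∈ t, r i| ≤ K * ‖f‖) →
      ∑ i ∈ s, |r i| ≤ 2 * (K * ‖f‖) := by
    intro r hr
    have h1 := hr (s.filter fun i => 0 ≤ r i) (Finset.filter_subset _ _)
    have h2 := hr (s.filter fun i => ¬ 0 ≤ r i) (Finset.filter_subset _ _)
    rw [← Finset.sum_filter_add_sum_filter_not s (fun i => 0 ≤ r i)]
    have e1 : ∑ i ∈ s with 0 ≤ r i, |r i| = ∑ i ∈ s with 0 ≤ r i, r i :=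
      Finset.sum_congr rfl fun i hi => abs_of_nonneg (Finset.mem_filter.1 hi).2
    have e2 : ∑ i ∈ s with ¬ 0 ≤ r i, |r i| = - ∑ i ∈ s with ¬ 0 ≤ r i, r i := by
      rw [← Finset.sum_neg_distrib]
      exact Finset.sum_congr rfl fun i hi =>
        abs_of_nonpos (not_le.1 (Finset.mem_filter.1 hi).2).le
    rw [e1, e2]
    linarith [(abs_le.1 h1).2, (abs_le.1 h2).1]
  have hf : ∀ t ⊆ s, ‖∑ i ∈ t, f (v i)‖ ≤ K * ‖f‖ := by
    intro t ht
    rw [← map_sum, mul_comm]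
    exact (f.le_opNorm _).trans (mul_le_mul_of_nonneg_left (hK t ht) (norm_nonneg _))
  have h1 := hre (fun i => (f (v i)).re) fun t ht => by
    rw [← Complex.re_sum]; exact (Complex.abs_re_le_norm _).trans (hf t ht)
  have h2 := hre (fun i => (f (v i)).im) fun t ht => by
    rw [← Complex.im_sum]; exact (Complex.abs_im_le_norm _).trans (hf t ht)
  calc ‖f (∑ i ∈ s, a i • v i)‖ = ‖∑ i ∈ s, a i * f (v i)‖ := by
        simp [map_sum]
    _ ≤ ∑ i ∈ s, B * (|(f (v i)).re| + |(f (v i)).im|) := by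
        refine (norm_sum_le _ _).trans (Finset.sum_le_sum fun i hi => ?_)
        rw [norm_mul]
        exact mul_le_mul (ha i hi) (Complex.norm_le_abs_re_add_abs_im _) (norm_nonneg _) hB
    _ = B * (∑ i ∈ s, |(f (v i)).re| + ∑ i ∈ s, |(f (v i)).im|) := by
        rw [← Finset.mul_sum, Finset.sum_add_distrib]
    _ ≤ B * (2 * (K * ‖f‖) + 2 * (K * ‖f‖)) := by gcongr
    _ = 4 * K * B * ‖f‖ := by ring

/-! ### Tagged partitions and refinement -/

namespace TaggedPartition

variable {S : BorelSet} (τ : TaggedPartition S)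

theorem subset {Δ : BorelSet} (h : Δ ∈ τ.cells.parts) : Δ.1 ⊆ S.1 :=
  (τ.cells.le h : Δ ≤ S)

theorem tag_mem_base {Δ : BorelSet} (h : Δ ∈ τ.cells.parts) : τ.tag Δ ∈ S.1 :=
  τ.subset h (τ.tag_mem Δ h)

theorem disjoint {Δ Δ' : BorelSet} (h : Δ ∈ τ.cells.parts) (h' : Δ' ∈ τ.cells.parts)
    (hne : Δ ≠ Δ') : Disjoint Δ.1 Δ'.1 := by
  have h1 : Δ ⊓ Δ' = ⊥ := (τ.cells.disjoint h h' hne).eq_bot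
  exact Set.disjoint_iff_inter_eq_empty.2 (congrArg Subtype.val h1)

end TaggedPartition

theorem BorelSet.coe_sup_id (s : Finset BorelSet) : ((s.sup id : BorelSet) : Set ℂ) =
    ⋃ Δ ∈ s, Δ.1 := by
  classical
  induction s using Finset.induction_on with
  | empty => simp
  | insert a s _ ih =>
    rw [Finset.sup_insert, Finset.set_biUnion_insert, ← ih]
    rfl

theorem TaggedPartition.iUnion_cells {S : BorelSet} (τ : TaggedPartition S) :
    ⋃ Δ ∈ τ.cells.parts, Δ.1 = S.1 := by
  rw [← BorelSet.coe_sup_id, τ.cells.sup_parts]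

/-- A Borel partition of a subset extends to a partition of the whole set. -/
theorem exists_extend_partition {S S' : BorelSet} (h : S' ≤ S) (π : Finpartition S') :
    ∃ π' : Finpartition S, ∀ Δ ∈ π'.parts, Δ ∈ π.parts ∨ Disjoint Δ.1 S'.1 := by
  classical
  rcases h.eq_or_lt with rfl | hlt
  · exact ⟨π, fun Δ h => Or.inl h⟩
  · refine ⟨π.extendOfLE h, fun Δ hΔ => ?_⟩
    rw [Finpartition.parts_extendOfLE_of_lt π hlt, Finset.mem_insert] at hΔ
    rcases hΔ with rfl | hΔ
    · right
      exact Set.disjoint_sdiff_left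
    · exact Or.inl hΔ

theorem eventually_refines {S : BorelSet} (π : Finpartition S) :
    ∀ᶠ τ in refinement S, τ.cells ≤ π :=
  mem_iInf_of_mem π (mem_principal_self _)

theorem refinement_hasBasis (S : BorelSet) :
    (refinement S).HasBasis (fun _ : Finpartition S => True) fun π => {τ | τ.cells ≤ π} := by
  classical
  refine hasBasis_iInf_principal ?_
  intro a b
  exact ⟨a ⊓ b, fun τ (h : τ.cells ≤ a ⊓ b) => h.trans inf_le_left,
    fun τ (h : τ.cells ≤ a ⊓ b) => h.trans inf_le_right⟩

/-- Fine partitions do not cut across a given Borel set. -/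
theorem eventually_subset_or_disjoint (S : BorelSet) {A : Set ℂ} (hA : MeasurableSet A) :
    ∀ᶠ τ in refinement S, ∀ Δ ∈ τ.cells.parts, Δ.1 ⊆ A ∨ Disjoint Δ.1 A := by
  classical
  let S' : BorelSet := ⟨S.1 ∩ A, S.2.inter hA⟩
  obtain ⟨τ', -⟩ := exists_tagged (⊤ : Finpartition S')
  obtain ⟨π, hπ⟩ := exists_extend_partition (S := S) (S' := S') Set.inter_subset_left τ'.cells
  filter_upwards [eventually_refines π] with τ hτ Δ hΔ
  obtain ⟨Δ', h', hle⟩ := hτ hΔ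
  rcases hπ Δ' h' with h1 | h1
  · exact Or.inl ((show Δ.1 ⊆ Δ'.1 from hle).trans ((τ'.subset h1).trans Set.inter_subset_right))
  · right
    have h2 : Disjoint Δ.1 (S.1 ∩ A) := h1.mono_left hle
    rw [Set.disjoint_left] at h2 ⊢
    exact fun z hz hzA => h2 hz ⟨τ.subset hΔ hz, hzA⟩

/-- A limit of Riemann sums over a Borel subset `S' ⊆ S` is the limit of the corresponding
partial Riemann sums over `S`. -/
theorem tendsto_sum_of_subset {V : Type*} [AddCommMonoid V] [TopologicalSpace V]
    {S S' : BorelSet} (h : S' ≤ S) (F : ℂ → Set ℂ → V) {T : V}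
    (hF : Tendsto (fun τ : TaggedPartition S' => ∑ Δ ∈ τ.cells.parts, F (τ.tag Δ) Δ.1)
      (refinement S') (𝓝 T)) [DecidablePred (· ∈ S'.1)] :
    Tendsto (fun τ : TaggedPartition S =>
      ∑ Δ ∈ τ.cells.parts, if τ.tag Δ ∈ S'.1 then F (τ.tag Δ) Δ.1 else 0)
      (refinement S) (𝓝 T) := by
  classical
  intro U hU
  obtain ⟨π, -, hπ⟩ := (refinement_hasBasis S').mem_iff.1 (hF hU)
  obtain ⟨π', hπ'⟩ := exists_extend_partition h π
  refine mem_map.2 ?_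
  filter_upwards [eventually_refines π'] with τ hτ
  have hcell : ∀ Δ ∈ τ.cells.parts, τ.tag Δ ∈ S'.1 → ∃ Δ' ∈ π.parts, Δ ≤ Δ' := by
    intro Δ hΔ ht
    obtain ⟨Δ', h', hle⟩ := hτ hΔ
    rcases hπ' Δ' h' with h1 | h1
    · exact ⟨Δ', h1, hle⟩
    · exact absurd ht (Set.disjoint_left.1 h1 (hle (τ.tag_mem Δ hΔ)))
  -- the cells of `τ` inside `S'`, recognized by their tags, form a partition of `S'` finer than `π`
  let P := τ.cells.parts.filter fun Δ => τ.tag Δ ∈ S'.1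
  have hsup : P.sup id = S' := by
    apply Subtype.ext
    rw [BorelSet.coe_sup_id]
    apply Set.Subset.antisymm
    · refine Set.iUnion₂_subset fun Δ hΔ => ?_
      obtain ⟨h1, h2⟩ := Finset.mem_filter.1 hΔ
      obtain ⟨Δ', h3, h4⟩ := hcell Δ h1 h2
      exact (h4 : Δ.1 ⊆ Δ'.1).trans (π.le h3 : Δ' ≤ S')
    · intro z hz
      have hzS : z ∈ S.1 := (h : S'.1 ⊆ S.1) hz
      rw [← τ.iUnion_cells, Set.mem_iUnion₂] at hzS
      obtain ⟨Δ, hΔ, hzΔ⟩ := hzS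
      refine Set.mem_iUnion₂.2 ⟨Δ, Finset.mem_filter.2 ⟨hΔ, ?_⟩, hzΔ⟩
      obtain ⟨Δ', h', hle⟩ := hτ hΔ
      rcases hπ' Δ' h' with h1 | h1
      · exact (π.le h1 : Δ' ≤ S') (hle (τ.tag_mem Δ hΔ))
      · exact absurd hz (Set.disjoint_left.1 h1 (hle hzΔ))
  let τ' : TaggedPartition S' :=
    { cells := τ.cells.ofSubset (Finset.filter_subset _ _) hsup
      tag := τ.tag
      tag_mem := fun Δ hΔ => τ.tag_mem Δ (Finset.mem_filter.1 hΔ).1 }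
  have hτ' : τ'.cells ≤ π := by
    intro Δ hΔ
    obtain ⟨h1, h2⟩ := Finset.mem_filter.1 hΔ
    exact hcell Δ h1 h2
  have := hπ hτ'
  change ∑ Δ ∈ P, F (τ.tag Δ) Δ.1 ∈ U at this
  rw [Finset.sum_filter] at this
  exact this

/-! ### The spectral measure -/

variable {H : Type*} [NormedAddCommGroup H] [InnerProductSpace ℂ H] [CompleteSpace H]

namespace SpectralDecomposition

variable {X : H →L[ℂ] H} (R : SpectralDecomposition X)

theorem E_empty : R.E ∅ = 0 := by
  ext x
  have h := R.E_iUnion (fun _ => ∅) (fun _ => MeasurableSet.empty)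
    (fun _ _ _ => disjoint_bot_left) x
  simpa using (tendsto_nhds_unique h.summable.tendsto_atTop_zero tendsto_const_nhds).symm

open Classical in
/-- The `H`-valued vector measure `A ↦ E(A) x`. -/
noncomputable def vectorMeasure (x : H) : MeasureTheory.VectorMeasure ℂ H where
  measureOf' A := if MeasurableSet A then R.E A x else 0
  empty' := by simp [E_empty]
  not_measurable' A hA := by simp [hA]
  m_iUnion' A hA hd := by
    simp only [hA, MeasurableSet.iUnion hA, if_true]
    exact R.E_iUnion A hA hd x

theorem vectorMeasure_apply (x : H) {A : Set ℂ} (hA : MeasurableSet A) :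
    R.vectorMeasure x A = R.E A x := if_pos hA

/-- The values of a spectral measure are uniformly bounded. -/
theorem exists_norm_E_le : ∃ K : ℝ, ∀ A : Set ℂ, MeasurableSet A → ‖R.E A‖ ≤ K := by
  obtain ⟨K, hK⟩ := banach_steinhaus (g := fun A : BorelSet => R.E A.1) fun x =>
    ⟨(letI : NormedSpace ℝ H := NormedSpace.restrictScalars ℝ ℂ H
      ((R.vectorMeasure x).bound : ℝ)), fun A => by
      rw [← R.vectorMeasure_apply x A.2]
      exact MeasureTheory.VectorMeasure.norm_apply_le_bound⟩
  exact ⟨K, fun A hA => hK ⟨A, hA⟩⟩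

theorem sum_E (s : Finset BorelSet)
    (hs : ∀ Δ ∈ s, ∀ Δ' ∈ s, Δ ≠ Δ' → Disjoint Δ.1 Δ'.1) :
    ∑ Δ ∈ s, R.E Δ.1 = R.E (⋃ Δ ∈ s, Δ.1) := by
  ext x
  have h := MeasureTheory.VectorMeasure.of_biUnion_finset (v := R.vectorMeasure x) (s := s)
    (f := Subtype.val) (fun Δ h Δ' h' hne => hs Δ h Δ' h' hne) (fun Δ _ => Δ.2)
  rw [R.vectorMeasure_apply x (s.measurableSet_biUnion fun Δ _ => Δ.2)] at h
  rw [h, sum_apply]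
  exact Finset.sum_congr rfl fun Δ _ => (R.vectorMeasure_apply x Δ.2).symm

theorem E_mul_self {A : Set ℂ} (hA : MeasurableSet A) : R.E A * R.E A = R.E A := by
  rw [← R.E_inter A A hA hA, Set.inter_self]

theorem E_mul_of_disjoint {A B : Set ℂ} (hA : MeasurableSet A) (hB : MeasurableSet B)
    (h : Disjoint A B) : R.E A * R.E B = 0 := by
  rw [← R.E_inter A B hA hB, h.inter_eq, E_empty]

/-! ### Riemann sums against one spectral measure -/

/-- The Riemann sum `∑_Δ F(s_Δ) E(Δ)` of an operator-valued function. -/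
noncomputable def rsum (F : ℂ → H →L[ℂ] H) (τ : TaggedPartition (spec X)) : H →L[ℂ] H :=
  ∑ Δ ∈ τ.cells.parts, F (τ.tag Δ) * R.E Δ.1

variable {R}

theorem rsum_mul_E {F : ℂ → H →L[ℂ] H} {τ : TaggedPartition (spec X)}
    {Δ : BorelSet} (hΔ : Δ ∈ τ.cells.parts) :
    R.rsum F τ * R.E Δ.1 = F (τ.tag Δ) * R.E Δ.1 := by
  rw [rsum, Finset.sum_mul, Finset.sum_eq_single_of_mem Δ hΔ]
  · rw [mul_assoc, R.E_mul_self Δ.2]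
  · intro Δ' h' hne
    rw [mul_assoc, R.E_mul_of_disjoint Δ'.2 Δ.2 (τ.disjoint h' hΔ hne), mul_zero]

theorem commute_rsum_E {F : ℂ → H →L[ℂ] H} (τ : TaggedPartition (spec X))
    (hF : ∀ z A, MeasurableSet A → Commute (F z) (R.E A)) {A : Set ℂ} (hA : MeasurableSet A) :
    Commute (R.rsum F τ) (R.E A) := by
  refine Commute.sum_left _ _ _ fun Δ _ => (hF _ _ hA).mul_left ?_
  rw [Commute, SemiconjBy, ← R.E_inter _ _ Δ.2 hA, ← R.E_inter _ _ hA Δ.2, Set.inter_comm]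

theorem E_mul_rsum {F : ℂ → H →L[ℂ] H} {τ : TaggedPartition (spec X)}
    (hF : ∀ z A, MeasurableSet A → Commute (F z) (R.E A))
    {Δ : BorelSet} (hΔ : Δ ∈ τ.cells.parts) :
    R.E Δ.1 * R.rsum F τ = F (τ.tag Δ) * R.E Δ.1 := by
  rw [← (commute_rsum_E τ hF Δ.2).eq, rsum_mul_E hΔ]

/-- Since the values of `E` on disjoint cells annihilate each other, Riemann sums over one tagged
partition are multiplicative. -/
theorem rsum_mul {F G : ℂ → H →L[ℂ] H} {τ : TaggedPartition (spec X)}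
    (hG : ∀ z A, MeasurableSet A → Commute (G z) (R.E A)) :
    R.rsum F τ * R.rsum G τ = R.rsum (fun z => F z * G z) τ := by
  conv_lhs => rw [rsum, Finset.sum_mul]
  refine Finset.sum_congr rfl fun Δ hΔ => ?_
  rw [mul_assoc, E_mul_rsum hG hΔ, mul_assoc]

theorem rsum_congr {F G : ℂ → H →L[ℂ] H} {τ : TaggedPartition (spec X)}
    (h : ∀ z ∈ spectrum ℂ X, F z = G z) : R.rsum F τ = R.rsum G τ :=
  Finset.sum_congr rfl fun Δ hΔ => by rw [h _ (τ.tag_mem_base hΔ)]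

theorem rsum_one (τ : TaggedPartition (spec X)) : R.rsum (fun _ => 1) τ = 1 := by
  simp only [rsum, one_mul]
  rw [R.sum_E _ fun Δ h Δ' h' hne => τ.disjoint h h' hne, τ.iUnion_cells]
  exact R.E_spectrum

theorem rsum_sub (F G : ℂ → H →L[ℂ] H) (τ : TaggedPartition (spec X)) :
    R.rsum (fun z => F z - G z) τ = R.rsum F τ - R.rsum G τ := by
  simp [rsum, sub_mul]

theorem rsum_pow {F : ℂ → H →L[ℂ] H} {τ : TaggedPartition (spec X)}
    (hF : ∀ z A, MeasurableSet A → Commute (F z) (R.E A)) (n : ℕ) :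
    R.rsum F τ ^ n = R.rsum (fun z => F z ^ n) τ := by
  induction n with
  | zero => simp [rsum_one]
  | succ n ih =>
    rw [pow_succ, ih, rsum_mul hF]
    rfl

variable (R) in
/-- The Riemann sum `∑_Δ f(s_Δ) E(Δ)` of a scalar function. -/
noncomputable def ssum (f : ℂ → ℂ) (τ : TaggedPartition (spec X)) : H →L[ℂ] H :=
  ∑ Δ ∈ τ.cells.parts, f (τ.tag Δ) • R.E Δ.1

theorem ssum_eq_rsum (f : ℂ → ℂ) (τ : TaggedPartition (spec X)) :
    R.ssum f τ = R.rsum (fun z => f z • 1) τ := by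
  simp [ssum, rsum]

theorem ssum_add (f g : ℂ → ℂ) (τ : TaggedPartition (spec X)) :
    R.ssum (f + g) τ = R.ssum f τ + R.ssum g τ := by
  simp [ssum, add_smul, Finset.sum_add_distrib]

theorem ssum_sub (f g : ℂ → ℂ) (τ : TaggedPartition (spec X)) :
    R.ssum (f - g) τ = R.ssum f τ - R.ssum g τ := by
  simp [ssum, sub_smul, Finset.sum_sub_distrib]

theorem ssum_mul (f g : ℂ → ℂ) (τ : TaggedPartition (spec X)) :
    R.ssum (f * g) τ = R.ssum f τ * R.ssum g τ := by
  rw [ssum_eq_rsum, ssum_eq_rsum, ssum_eq_rsum,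
    rsum_mul fun z A _ => (Commute.one_left _).smul_left _]
  simp [smul_smul, mul_comm]

theorem ssum_const (c : ℂ) (τ : TaggedPartition (spec X)) :
    R.ssum (fun _ => c) τ = c • 1 := by
  rw [← rsum_one (R := R) τ, ssum, rsum, Finset.smul_sum]
  simp

variable (R) in
/-- Riemann sums are controlled by the supremum of the integrand, uniformly in the partition. -/
theorem exists_norm_ssum_le : ∃ C : ℝ, 0 ≤ C ∧ ∀ (f : ℂ → ℂ) (B : ℝ), 0 ≤ B →
    (∀ z ∈ spectrum ℂ X, ‖f z‖ ≤ B) → ∀ τ, ‖R.ssum f τ‖ ≤ C * B := by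
  obtain ⟨K, hK⟩ := R.exists_norm_E_le
  have hK0 : 0 ≤ K := (norm_nonneg _).trans (hK ∅ MeasurableSet.empty)
  refine ⟨4 * K, by positivity, fun f B hB hf τ => ?_⟩
  refine norm_sum_smul_le_of_subset_sums _ _ _ hB (fun t ht => ?_)
    fun Δ hΔ => hf _ (τ.tag_mem_base hΔ)
  rw [R.sum_E t fun Δ h Δ' h' hne => τ.disjoint (ht h) (ht h') hne]
  exact hK _ (t.measurableSet_biUnion fun Δ _ => Δ.2)

variable (R) in
/-- `∫ f dE` exists, as a norm limit of Riemann sums along refinement. -/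
def Integrable (f : ℂ → ℂ) : Prop := ∃ T, Tendsto (R.ssum f) (refinement (spec X)) (𝓝 T)

namespace Integrable

theorem add {f g : ℂ → ℂ} (hf : R.Integrable f) (hg : R.Integrable g) :
    R.Integrable (f + g) := by
  obtain ⟨T, hT⟩ := hf
  obtain ⟨U, hU⟩ := hg
  exact ⟨T + U, (hT.add hU).congr fun τ => (ssum_add f g τ).symm⟩

theorem sub {f g : ℂ → ℂ} (hf : R.Integrable f) (hg : R.Integrable g) :
    R.Integrable (f - g) := by
  obtain ⟨T, hT⟩ := hf
  obtain ⟨U, hU⟩ := hg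
  exact ⟨T - U, (hT.sub hU).congr fun τ => (ssum_sub f g τ).symm⟩

theorem mul {f g : ℂ → ℂ} (hf : R.Integrable f) (hg : R.Integrable g) :
    R.Integrable (f * g) := by
  obtain ⟨T, hT⟩ := hf
  obtain ⟨U, hU⟩ := hg
  exact ⟨T * U, (hT.mul hU).congr fun τ => (ssum_mul f g τ).symm⟩

theorem const (c : ℂ) : R.Integrable fun _ => c :=
  ⟨c • 1, tendsto_const_nhds.congr fun τ => (ssum_const c τ).symm⟩

theorem pow {f : ℂ → ℂ} (hf : R.Integrable f) : ∀ n : ℕ, R.Integrable (f ^ n)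
  | 0 => const 1
  | n + 1 => by rw [pow_succ]; exact (pow hf n).mul hf

theorem indicator {A : Set ℂ} (hA : MeasurableSet A) : R.Integrable (A.indicator 1) := by
  classical
  refine ⟨R.E (spectrum ℂ X ∩ A), Tendsto.congr' ?_ tendsto_const_nhds⟩
  filter_upwards [eventually_subset_or_disjoint (spec X) hA] with τ hτ
  have h1 : R.ssum (A.indicator 1) τ =
      ∑ Δ ∈ τ.cells.parts with Δ.1 ⊆ A, R.E Δ.1 := by
    rw [ssum, Finset.sum_filter]
    refine Finset.sum_congr rfl fun Δ hΔ => ?_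
    have ht := τ.tag_mem Δ hΔ
    rcases hτ Δ hΔ with h | h
    · simp [h, h ht]
    · have h2 : τ.tag Δ ∉ A := Set.disjoint_left.1 h ht
      have h3 : ¬ Δ.1 ⊆ A := fun h3 => h2 (h3 ht)
      simp [h2, h3]
  rw [h1, R.sum_E _ fun Δ h Δ' h' hne =>
    τ.disjoint (Finset.mem_filter.1 h).1 (Finset.mem_filter.1 h').1 hne]
  congr 1
  ext z
  simp only [Set.mem_inter_iff, Set.mem_iUnion, Finset.mem_filter, exists_prop]
  constructor
  · rintro ⟨hz, hzA⟩
    have hz' : z ∈ ⋃ Δ ∈ τ.cells.parts, Δ.1 := by rw [τ.iUnion_cells]; exact hz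
    obtain ⟨Δ, hΔ, hzΔ⟩ := Set.mem_iUnion₂.1 hz'
    refine ⟨Δ, ⟨hΔ, (hτ Δ hΔ).resolve_right fun h => Set.disjoint_left.1 h hzΔ hzA⟩, hzΔ⟩
  · rintro ⟨Δ, ⟨hΔ, hΔA⟩, hzΔ⟩
    exact ⟨τ.subset hΔ hzΔ, hΔA hzΔ⟩

/-- Uniform limits of integrable functions are integrable. -/
theorem of_uniform {f : ℂ → ℂ} (h : ∀ ε > 0, ∃ g, R.Integrable g ∧
    ∀ z ∈ spectrum ℂ X, ‖f z - g z‖ ≤ ε) : R.Integrable f := by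
  obtain ⟨C, hC, hbound⟩ := R.exists_norm_ssum_le
  apply cauchy_map_iff_exists_tendsto.1
  rw [Metric.cauchy_iff]
  refine ⟨inferInstance, fun ε hε => ?_⟩
  obtain ⟨g, ⟨T, hT⟩, hg⟩ := h (ε / (4 * (C + 1))) (by positivity)
  have hfg : ∀ τ, ‖R.ssum f τ - R.ssum g τ‖ ≤ ε / 4 := by
    intro τ
    rw [← ssum_sub]
    refine (hbound (f - g) _ (by positivity) hg τ).trans ?_
    rw [mul_div_assoc', div_le_div_iff₀ (by positivity) (by norm_num)]
    nlinarith
  refine ⟨R.ssum f '' {τ | dist (R.ssum g τ) T < ε / 4},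
    image_mem_map (hT (Metric.ball_mem_nhds T (by positivity))), ?_⟩
  have key : ∀ τ, dist (R.ssum g τ) T < ε / 4 → dist (R.ssum f τ) T < ε / 2 := by
    intro τ hτ
    have := dist_triangle (R.ssum f τ) (R.ssum g τ) T
    rw [dist_eq_norm (R.ssum f τ) (R.ssum g τ)] at this
    linarith [hfg τ]
  rintro _ ⟨τ, hτ, rfl⟩ _ ⟨τ', hτ', rfl⟩
  have := dist_triangle_right (R.ssum f τ) (R.ssum f τ') T
  linarith [key τ hτ, key τ' hτ']

/-- The identity function is a uniform limit of simple functions on the compact spectrum. -/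
protected theorem id : R.Integrable fun z => z := by
  classical
  refine of_uniform fun ε hε => ?_
  have hind : ∃ (g : ℂ → ℂ) (B : Set ℂ), MeasurableSet B ∧ R.Integrable g ∧
      spectrum ℂ X ⊆ B ∧ ∀ z ∈ B, ‖z - g z‖ ≤ ε := by
    refine (spectrum.isCompact X).induction_on (p := fun A => ∃ (g : ℂ → ℂ) (B : Set ℂ),
      MeasurableSet B ∧ R.Integrable g ∧ A ⊆ B ∧ ∀ z ∈ B, ‖z - g z‖ ≤ ε) ?_ ?_ ?_ ?_
    · exact ⟨fun _ => 0, ∅, MeasurableSet.empty, const 0, subset_rfl, by simp⟩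
    · rintro s t hst ⟨g, B, h1, h2, h3, h4⟩
      exact ⟨g, B, h1, h2, hst.trans h3, h4⟩
    -- use the first approximation on `B` and the second one on `B' \ B`
    · rintro s t ⟨g, B, h1, h2, h3, h4⟩ ⟨g', B', h1', h2', h3', h4'⟩
      refine ⟨B.indicator 1 * g + (fun _ => 1) * g' - B.indicator 1 * g', B ∪ B', h1.union h1',
        (((indicator h1).mul h2).add ((const 1).mul h2')).sub ((indicator h1).mul h2'),
        Set.union_subset_union h3 h3', ?_⟩
      intro z hz
      by_cases hzB : z ∈ B
      · simpa [hzB] using h4 z hzB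
      · simpa [hzB] using h4' z (hz.resolve_left hzB)
    · intro a _
      refine ⟨Metric.ball a ε, mem_nhdsWithin_of_mem_nhds (Metric.ball_mem_nhds a hε),
        fun _ => a, Metric.ball a ε, measurableSet_ball, const a, subset_rfl, fun z hz => ?_⟩
      rw [← dist_eq_norm]
      exact (Metric.mem_ball.1 hz).le
  obtain ⟨g, B, -, h2, h3, h4⟩ := hind
  exact ⟨g, h2, fun z hz => h4 z (h3 hz)⟩

end Integrable

/-! ### The nilpotent part -/

theorem commute_sub_smul_E (z : ℂ) {A : Set ℂ} (hA : MeasurableSet A) :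
    Commute (X - z • (1 : H →L[ℂ] H)) (R.E A) :=
  (R.E_commute A hA).sub_left ((Commute.one_left _).smul_left _)

variable (R) in
/-- The Riemann sums `∑_Δ [a < m(s_Δ)] (X - s_Δ)^a E(Δ)` (without the restriction on `m` when
`a = 0`) of the powers of the nilpotent part. -/
noncomputable def powSum (a : ℕ) : TaggedPartition (spec X) → H →L[ℂ] H :=
  R.rsum fun z => if a = 0 ∨ a < R.m z then (X - z • (1 : H →L[ℂ] H)) ^ a else 0

variable (R) in
theorem commute_ite_pow_E (a : ℕ) (z : ℂ) (A : Set ℂ) (hA : MeasurableSet A) :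
    Commute (if a = 0 ∨ a < R.m z then (X - z • (1 : H →L[ℂ] H)) ^ a else 0) (R.E A) := by
  split_ifs
  · exact (commute_sub_smul_E z hA).pow_left a
  · exact Commute.zero_left _

/-- Where `m ≤ a`, the function `(X - λ)^a` does not contribute in the limit. -/
theorem tendsto_rsum_ite_m_le (a : ℕ) :
    Tendsto (R.rsum fun z => if R.m z ≤ a then (X - z • (1 : H →L[ℂ] H)) ^ a else 0)
      (refinement (spec X)) (𝓝 0) := by
  classical
  refine (tendsto_sum_of_subset (S := spec X) (S' := ⟨spectrum ℂ X ∩ {z | R.m z ≤ a}, _⟩)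
    Set.inter_subset_left (fun z A => (X - z • (1 : H →L[ℂ] H)) ^ a * R.E A)
    (R.nilpotent a)).congr fun τ => Finset.sum_congr rfl fun Δ hΔ => ?_
  have : τ.tag Δ ∈ spectrum ℂ X := τ.tag_mem_base hΔ
  simp only [Set.mem_inter_iff, this, true_and, Set.mem_ofPred_eq]
  split_ifs <;> simp

variable (R) in
/-- The operator `N = ∫ (X - λ) dE(λ)` is nilpotent, and its powers are the limits of the Riemann
sums `powSum`. -/
theorem exists_nilpotentPart : ∃ N : H →L[ℂ] H,
    (∀ a, Tendsto (R.powSum a) (refinement (spec X)) (𝓝 (N ^ a))) ∧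
    ∀ M, (∀ z ∈ spectrum ℂ X, R.m z ≤ M) → N ^ M = 0 := by
  obtain ⟨J, hJ⟩ := Integrable.id (R := R)
  have h1 : Tendsto (R.rsum fun z => X - z • (1 : H →L[ℂ] H)) (refinement (spec X))
      (𝓝 (X - J)) := by
    refine (hJ.const_sub X).congr fun τ => ?_
    rw [rsum_sub, ssum_eq_rsum]
    congr 1
    conv_lhs => rw [← mul_one X, ← rsum_one (R := R) τ, rsum, Finset.mul_sum]
    simp [rsum]
  have hpow : ∀ a, Tendsto (R.rsum fun z => (X - z • (1 : H →L[ℂ] H)) ^ a)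
      (refinement (spec X)) (𝓝 ((X - J) ^ a)) := fun a =>
    (h1.pow a).congr fun τ => rsum_pow (fun z A hA => commute_sub_smul_E z hA) a
  refine ⟨X - J, fun a => ?_, fun M hM => ?_⟩
  · rcases Nat.eq_zero_or_pos a with rfl | ha
    · simpa [powSum] using hpow 0
    · rw [← sub_zero ((X - J) ^ a)]
      refine ((hpow a).sub (tendsto_rsum_ite_m_le (R := R) a)).congr fun τ => ?_
      rw [← rsum_sub]
      refine rsum_congr fun z _ => ?_
      by_cases h : R.m z ≤ a
      · simp [h, ha.ne', not_lt.2 h]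
      · simp [h, not_le.1 h]
  · refine tendsto_nhds_unique (hpow M) ((tendsto_rsum_ite_m_le (R := R) M).congr fun τ =>
      rsum_congr fun z hz => ?_)
    simp [hM z hz]

end SpectralDecomposition

end GDOI

namespace GDOI

/-! ### Double Riemann sums with scalar coefficients -/

variable {H : Type*} [NormedAddCommGroup H] [InnerProductSpace ℂ H] [CompleteSpace H]
  {X₁ X₂ : H →L[ℂ] H} (R₁ : SpectralDecomposition X₁) (R₂ : SpectralDecomposition X₂)

/-- The Riemann sum of `∫∫ φ(λ₁,λ₂) dE₁(λ₁) Y dE₂(λ₂)`. -/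
noncomputable def dsum (φ : ℂ × ℂ → ℂ) (Y : H →L[ℂ] H)
    (τ : TaggedPartition (spec X₁) × TaggedPartition (spec X₂)) : H →L[ℂ] H :=
  ∑ Δ₁ ∈ τ.1.cells.parts, ∑ Δ₂ ∈ τ.2.cells.parts,
    φ (τ.1.tag Δ₁, τ.2.tag Δ₂) • (R₁.E Δ₁.1 * Y * R₂.E Δ₂.1)

section dsum

variable {R₁ R₂} {τ : TaggedPartition (spec X₁) × TaggedPartition (spec X₂)}

theorem dsum_congr {φ ψ : ℂ × ℂ → ℂ}
    (h : ∀ z ∈ spectrum ℂ X₁ ×ˢ spectrum ℂ X₂, φ z = ψ z) (Y : H →L[ℂ] H) :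
    dsum R₁ R₂ φ Y τ = dsum R₁ R₂ ψ Y τ :=
  Finset.sum_congr rfl fun Δ₁ h₁ => Finset.sum_congr rfl fun Δ₂ h₂ => by
    rw [h (τ.1.tag Δ₁, τ.2.tag Δ₂) ⟨τ.1.tag_mem_base h₁, τ.2.tag_mem_base h₂⟩]

theorem dsum_add (φ ψ : ℂ × ℂ → ℂ) (Y : H →L[ℂ] H) :
    dsum R₁ R₂ (φ + ψ) Y τ = dsum R₁ R₂ φ Y τ + dsum R₁ R₂ ψ Y τ := by
  simp [dsum, add_smul, Finset.sum_add_distrib]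

theorem dsum_smul (c : ℂ) (φ : ℂ × ℂ → ℂ) (Y : H →L[ℂ] H) :
    dsum R₁ R₂ (c • φ) Y τ = c • dsum R₁ R₂ φ Y τ := by
  simp [dsum, Finset.smul_sum, smul_smul]

theorem dsum_sum {ι : Type*} (s : Finset ι) (φ : ι → ℂ × ℂ → ℂ) (Y : H →L[ℂ] H) :
    dsum R₁ R₂ (∑ i ∈ s, φ i) Y τ = ∑ i ∈ s, dsum R₁ R₂ (φ i) Y τ := by
  classical
  induction s using Finset.induction_on with
  | empty => simp [dsum]
  | insert i s hi ih => rw [Finset.sum_insert hi, Finset.sum_insert hi, dsum_add, ih]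

theorem dsum_add_right (φ : ℂ × ℂ → ℂ) (Y Z : H →L[ℂ] H) :
    dsum R₁ R₂ φ (Y + Z) τ = dsum R₁ R₂ φ Y τ + dsum R₁ R₂ φ Z τ := by
  simp [dsum, mul_add, add_mul, smul_add, Finset.sum_add_distrib]

theorem E_mul_dsum_mul_E (φ : ℂ × ℂ → ℂ) (Y : H →L[ℂ] H) {Δ₁ Δ₂ : BorelSet}
    (h₁ : Δ₁ ∈ τ.1.cells.parts) (h₂ : Δ₂ ∈ τ.2.cells.parts) :
    R₁.E Δ₁.1 * dsum R₁ R₂ φ Y τ * R₂.E Δ₂.1 =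
      φ (τ.1.tag Δ₁, τ.2.tag Δ₂) • (R₁.E Δ₁.1 * Y * R₂.E Δ₂.1) := by
  rw [dsum, Finset.mul_sum, Finset.sum_mul, Finset.sum_eq_single_of_mem Δ₁ h₁,
    Finset.mul_sum, Finset.sum_mul, Finset.sum_eq_single_of_mem Δ₂ h₂]
  · rw [mul_smul_comm, smul_mul_assoc, mul_assoc, mul_assoc (R₁.E Δ₁.1 * Y),
      R₂.E_mul_self Δ₂.2, ← mul_assoc, ← mul_assoc, R₁.E_mul_self Δ₁.2]
  · intro Δ h hne
    rw [mul_smul_comm, smul_mul_assoc, mul_assoc, mul_assoc (R₁.E Δ₁.1 * Y),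
      R₂.E_mul_of_disjoint Δ.2 Δ₂.2 (τ.2.disjoint h h₂ hne)]
    simp
  · intro Δ h hne
    rw [Finset.mul_sum, Finset.sum_mul]
    refine Finset.sum_eq_zero fun Δ' _ => ?_
    rw [mul_smul_comm, smul_mul_assoc, ← mul_assoc, ← mul_assoc,
      R₁.E_mul_of_disjoint Δ₁.2 Δ.2 (τ.1.disjoint h₁ h hne.symm)]
    simp

/-- Over one pair of tagged partitions, double Riemann sums compose multiplicatively. -/
theorem dsum_dsum (φ ψ : ℂ × ℂ → ℂ) (Y : H →L[ℂ] H) :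
    dsum R₁ R₂ φ (dsum R₁ R₂ ψ Y τ) τ = dsum R₁ R₂ (φ * ψ) Y τ := by
  refine Finset.sum_congr rfl fun Δ₁ h₁ => Finset.sum_congr rfl fun Δ₂ h₂ => ?_
  rw [E_mul_dsum_mul_E ψ Y h₁ h₂, smul_smul]
  rfl

theorem dsum_tensor (f g : ℂ → ℂ) (Y : H →L[ℂ] H) :
    dsum R₁ R₂ (fun z => f z.1 * g z.2) Y τ = R₁.ssum f τ.1 * Y * R₂.ssum g τ.2 := by
  rw [dsum, SpectralDecomposition.ssum, SpectralDecomposition.ssum, Finset.sum_mul,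
    Finset.sum_mul]
  refine Finset.sum_congr rfl fun Δ₁ _ => ?_
  rw [Finset.mul_sum]
  refine Finset.sum_congr rfl fun Δ₂ _ => ?_
  rw [smul_mul_assoc, smul_mul_assoc, mul_smul_comm, smul_smul]

/-- Operator-valued factors of the integrand that commute with `E₁` can be moved from the Riemann
sum onto its argument. -/
theorem dsum_rsum_mul_rsum {F G : ℂ → H →L[ℂ] H}
    (hF : ∀ z A, MeasurableSet A → Commute (F z) (R₁.E A)) (φ : ℂ × ℂ → ℂ) (Y : H →L[ℂ] H) :
    dsum R₁ R₂ φ (R₁.rsum F τ.1 * Y * R₂.rsum G τ.2) τ =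
      ∑ Δ₁ ∈ τ.1.cells.parts, ∑ Δ₂ ∈ τ.2.cells.parts, φ (τ.1.tag Δ₁, τ.2.tag Δ₂) •
        (F (τ.1.tag Δ₁) * R₁.E Δ₁.1 * Y * (G (τ.2.tag Δ₂) * R₂.E Δ₂.1)) := by
  refine Finset.sum_congr rfl fun Δ₁ h₁ => Finset.sum_congr rfl fun Δ₂ h₂ => ?_
  rw [← SpectralDecomposition.E_mul_rsum hF h₁, ← SpectralDecomposition.rsum_mul_E h₂]
  simp only [mul_assoc]

end dsum

/-- `φ` is admissible if its double Riemann sums are uniformly bounded and converge in operator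
norm at every `Y`. -/
structure Admissible (φ : ℂ × ℂ → ℂ) : Prop where
  bound : ∃ C, ∀ τ Y, ‖dsum R₁ R₂ φ Y τ‖ ≤ C * ‖Y‖
  tendsto : ∀ Y, ∃ T, Tendsto (dsum R₁ R₂ φ Y) (refinement (spec X₁) ×ˢ refinement (spec X₂))
    (𝓝 T)

namespace Admissible

variable {R₁ R₂} {φ ψ : ℂ × ℂ → ℂ}

theorem congr (hφ : Admissible R₁ R₂ φ)
    (h : ∀ z ∈ spectrum ℂ X₁ ×ˢ spectrum ℂ X₂, φ z = ψ z) : Admissible R₁ R₂ ψ := by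
  obtain ⟨C, hC⟩ := hφ.bound
  refine ⟨⟨C, fun τ Y => ?_⟩, fun Y => ?_⟩
  · rw [← dsum_congr h]
    exact hC τ Y
  · obtain ⟨T, hT⟩ := hφ.tendsto Y
    exact ⟨T, hT.congr fun τ => dsum_congr h Y⟩

theorem add (hφ : Admissible R₁ R₂ φ) (hψ : Admissible R₁ R₂ ψ) :
    Admissible R₁ R₂ (φ + ψ) := by
  obtain ⟨C, hC⟩ := hφ.bound
  obtain ⟨C', hC'⟩ := hψ.bound
  refine ⟨⟨C + C', fun τ Y => ?_⟩, fun Y => ?_⟩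
  · rw [dsum_add, add_mul]
    exact (norm_add_le _ _).trans (add_le_add (hC τ Y) (hC' τ Y))
  · obtain ⟨T, hT⟩ := hφ.tendsto Y
    obtain ⟨T', hT'⟩ := hψ.tendsto Y
    exact ⟨T + T', (hT.add hT').congr fun τ => (dsum_add φ ψ Y).symm⟩

theorem smul (hφ : Admissible R₁ R₂ φ) (c : ℂ) : Admissible R₁ R₂ (c • φ) := by
  obtain ⟨C, hC⟩ := hφ.bound
  refine ⟨⟨‖c‖ * C, fun τ Y => ?_⟩, fun Y => ?_⟩
  · rw [dsum_smul, norm_smul, mul_assoc]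
    exact mul_le_mul_of_nonneg_left (hC τ Y) (norm_nonneg c)
  · obtain ⟨T, hT⟩ := hφ.tendsto Y
    exact ⟨c • T, (hT.const_smul c).congr fun τ => (dsum_smul c φ Y).symm⟩

theorem sub (hφ : Admissible R₁ R₂ φ) (hψ : Admissible R₁ R₂ ψ) :
    Admissible R₁ R₂ (φ - ψ) := by
  rw [sub_eq_add_neg, ← neg_one_smul ℂ ψ]
  exact hφ.add (hψ.smul _)

theorem zero : Admissible R₁ R₂ 0 :=
  ⟨⟨0, fun τ Y => by simp [dsum]⟩, fun Y => ⟨0, tendsto_const_nhds.congr fun τ => by simp [dsum]⟩⟩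

theorem sum {ι : Type*} {s : Finset ι} {φ : ι → ℂ × ℂ → ℂ}
    (h : ∀ i ∈ s, Admissible R₁ R₂ (φ i)) : Admissible R₁ R₂ (∑ i ∈ s, φ i) := by
  classical
  induction s using Finset.induction_on with
  | empty => simpa using zero
  | insert i s hi ih =>
    rw [Finset.sum_insert hi]
    exact (h i (Finset.mem_insert_self _ _)).add (ih fun j hj => h j (Finset.mem_insert_of_mem hj))

/-- The argument of a double Riemann sum may vary with the partition. -/
theorem tendsto_dsum (hφ : Admissible R₁ R₂ φ)
    {Z : TaggedPartition (spec X₁) × TaggedPartition (spec X₂) → H →L[ℂ] H} {Y T : H →L[ℂ] H}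
    (hZ : Tendsto Z (refinement (spec X₁) ×ˢ refinement (spec X₂)) (𝓝 Y))
    (hT : Tendsto (dsum R₁ R₂ φ Y) (refinement (spec X₁) ×ˢ refinement (spec X₂)) (𝓝 T)) :
    Tendsto (fun τ => dsum R₁ R₂ φ (Z τ) τ) (refinement (spec X₁) ×ˢ refinement (spec X₂))
      (𝓝 T) := by
  obtain ⟨C, hC⟩ := hφ.bound
  have h0 : Tendsto (fun τ => dsum R₁ R₂ φ (Z τ - Y) τ)
      (refinement (spec X₁) ×ˢ refinement (spec X₂)) (𝓝 0) := by
    refine squeeze_zero_norm (fun τ => hC τ _) ?_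
    have := (tendsto_iff_norm_sub_tendsto_zero.1 hZ).const_mul C
    rwa [mul_zero] at this
  have h1 := hT.add h0
  rw [add_zero] at h1
  refine h1.congr fun τ => ?_
  rw [← dsum_add_right, add_sub_cancel]

theorem mul (hφ : Admissible R₁ R₂ φ) (hψ : Admissible R₁ R₂ ψ) :
    Admissible R₁ R₂ (φ * ψ) := by
  obtain ⟨C, hC⟩ := hφ.bound
  obtain ⟨C', hC'⟩ := hψ.bound
  refine ⟨⟨|C| * C', fun τ Y => ?_⟩, fun Y => ?_⟩
  · rw [← dsum_dsum, mul_assoc]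
    refine (hC τ _).trans ?_
    exact (mul_le_mul_of_nonneg_right (le_abs_self C) (norm_nonneg _)).trans
      (mul_le_mul_of_nonneg_left (hC' τ Y) (abs_nonneg C))
  · obtain ⟨T, hT⟩ := hψ.tendsto Y
    obtain ⟨T', hT'⟩ := hφ.tendsto T
    exact ⟨T', (hφ.tendsto_dsum hT hT').congr fun τ => dsum_dsum φ ψ Y⟩

/-- Normally convergent series of admissible functions are admissible. -/
theorem of_hasSum {φ : ℕ → ℂ × ℂ → ℂ} {c : ℕ → ℝ} (hc : Summable c)
    (hφ : ∀ n, Admissible R₁ R₂ (φ n)) (hb : ∀ n τ Y, ‖dsum R₁ R₂ (φ n) Y τ‖ ≤ c n * ‖Y‖)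
    (hψ : ∀ z, HasSum (fun n => φ n z) (ψ z)) : Admissible R₁ R₂ ψ := by
  have hsum : ∀ Y τ, HasSum (fun n => dsum R₁ R₂ (φ n) Y τ) (dsum R₁ R₂ ψ Y τ) := fun Y τ =>
    hasSum_sum fun Δ₁ _ => hasSum_sum fun Δ₂ _ => (hψ _).smul_const _
  refine ⟨⟨∑' n, c n, fun τ Y => ?_⟩, fun Y => ?_⟩
  · rw [← (hsum Y τ).tsum_eq, ← tsum_mul_right]
    exact tsum_of_norm_bounded (hc.mul_right _).hasSum fun n => hb n τ Y
  · choose T hT using fun n => (hφ n).tendsto Y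
    refine ⟨∑' n, T n, ?_⟩
    refine (tendsto_tsum_of_dominated_convergence (hc.mul_right ‖Y‖) hT
      (Eventually.of_forall fun τ n => hb n τ Y)).congr fun τ => (hsum Y τ).tsum_eq

theorem tensor {f g : ℂ → ℂ} (hf : R₁.Integrable f) (hg : R₂.Integrable g) {C : ℝ}
    (hC : ∀ τ Y, ‖dsum R₁ R₂ (fun z => f z.1 * g z.2) Y τ‖ ≤ C * ‖Y‖) :
    Admissible R₁ R₂ fun z => f z.1 * g z.2 := by
  refine ⟨⟨C, hC⟩, fun Y => ?_⟩
  obtain ⟨T, hT⟩ := hf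
  obtain ⟨U, hU⟩ := hg
  exact ⟨T * Y * U, (((hT.comp tendsto_fst).mul_const Y).mul (hU.comp tendsto_snd)).congr
    fun τ => (dsum_tensor f g Y).symm⟩

end Admissible

/-- Double Riemann sums of tensor products are controlled by the suprema of the factors. -/
theorem exists_norm_dsum_tensor_le : ∃ C : ℝ, 0 ≤ C ∧ ∀ (f g : ℂ → ℂ) (B B' : ℝ), 0 ≤ B → 0 ≤ B' →
    (∀ z ∈ spectrum ℂ X₁, ‖f z‖ ≤ B) → (∀ z ∈ spectrum ℂ X₂, ‖g z‖ ≤ B') →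
    ∀ τ Y, ‖dsum R₁ R₂ (fun z => f z.1 * g z.2) Y τ‖ ≤ C * (B * B') * ‖Y‖ := by
  obtain ⟨C, hC0, hC⟩ := R₁.exists_norm_ssum_le
  obtain ⟨C', hC0', hC'⟩ := R₂.exists_norm_ssum_le
  refine ⟨C * C', by positivity, fun f g B B' hB hB' hf hg τ Y => ?_⟩
  rw [dsum_tensor]
  calc ‖R₁.ssum f τ.1 * Y * R₂.ssum g τ.2‖ ≤ ‖R₁.ssum f τ.1‖ * ‖Y‖ * ‖R₂.ssum g τ.2‖ :=
        (norm_mul_le _ _).trans (by gcongr; exact norm_mul_le _ _)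
    _ ≤ (C * B) * ‖Y‖ * (C' * B') := by
        gcongr
        · exact hC f B hB hf τ.1
        · exact hC' g B' hB' hg τ.2
    _ = C * C' * (B * B') * ‖Y‖ := by ring

/-! ### Analytic functions are admissible -/

/-- The expansion of a homogeneous polynomial on `ℂ²`, given by a multilinear map, into
monomials. -/
theorem multilinear_apply_prod (n : ℕ) (p : (ℂ × ℂ) [×n]→L[ℂ] ℂ) (x y : ℂ) :
    (p fun _ => (x, y)) = ∑ s : Finset (Fin n),
      p (s.piecewise (fun _ => (1, 0)) fun _ => (0, 1)) * (x ^ s.card * y ^ (n - s.card)) := by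
  classical
  have h1 : (fun _ : Fin n => (x, y)) = (fun _ => (x, 0)) + fun _ => (0, y) := by
    ext i <;> simp
  rw [h1]
  refine (p.toMultilinearMap.map_add_univ _ _).trans (Finset.sum_congr rfl fun s _ => ?_)
  have h2 : (s.piecewise (fun _ => (x, 0)) fun _ => (0, y) : Fin n → ℂ × ℂ) =
      fun i => (s.piecewise (fun _ => x) fun _ => y : Fin n → ℂ) i •
        (s.piecewise (fun _ => (1, 0)) fun _ => (0, 1) : Fin n → ℂ × ℂ) i := by
    ext i <;> by_cases hi : i ∈ s <;> simp [hi]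
  rw [h2, MultilinearMap.map_smul_univ]
  rw [Finset.prod_piecewise, smul_eq_mul, mul_comm]
  simp [Finset.card_sdiff, Finset.card_univ]

theorem norm_multilinear_piecewise_le (n : ℕ) (p : (ℂ × ℂ) [×n]→L[ℂ] ℂ) (s : Finset (Fin n)) :
    ‖p (s.piecewise (fun _ => (1, 0)) fun _ => (0, 1))‖ ≤ ‖p‖ := by
  refine (p.le_opNorm _).trans (mul_le_of_le_one_right (norm_nonneg _) ?_)
  refine Finset.prod_le_one (fun _ _ => norm_nonneg _) fun i _ => ?_
  by_cases hi : i ∈ s <;> simp [hi]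

variable {R₁ R₂}

/-- The Taylor series exhibits an analytic function on a small product of discs as a normally
convergent series of monomials, which are tensor products. -/
theorem Admissible.exists_local {φ : ℂ × ℂ → ℂ} {z₀ : ℂ × ℂ} (h : AnalyticAt ℂ φ z₀) :
    ∃ U ∈ 𝓝 z₀, Admissible R₁ R₂ (U.indicator 1) ∧ Admissible R₁ R₂ (U.indicator φ) := by
  classical
  obtain ⟨C, hC0, hC⟩ := exists_norm_dsum_tensor_le R₁ R₂
  obtain ⟨p, r, hp⟩ := h
  obtain ⟨q, hq0, hqr⟩ := ENNReal.lt_iff_exists_nnreal_btwn.1 hp.r_pos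
  have hq0' : (0 : ℝ) < q := by exact_mod_cast hq0
  set ρ : ℝ := q / 2 with hρ
  have hρ0 : 0 < ρ := by positivity
  let A := Metric.ball z₀.1 ρ
  let B := Metric.ball z₀.2 ρ
  let f : ℕ → ℂ → ℂ := fun k => A.indicator 1 * ((fun z => z) - fun _ => z₀.1) ^ k
  let g : ℕ → ℂ → ℂ := fun k => B.indicator 1 * ((fun z => z) - fun _ => z₀.2) ^ k
  have hpow : ∀ (a z : ℂ) (k : ℕ), ‖(Metric.ball a ρ).indicator 1 z * (z - a) ^ k‖ ≤ ρ ^ k := by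
    intro a z k
    by_cases hz : z ∈ Metric.ball a ρ
    · rw [Set.indicator_of_mem hz, Pi.one_apply, one_mul, norm_pow, ← dist_eq_norm]
      exact pow_le_pow_left₀ dist_nonneg (Metric.mem_ball.1 hz).le k
    · rw [Set.indicator_of_notMem hz, zero_mul, norm_zero]
      positivity
  have hfg : ∀ k l τ Y, ‖dsum R₁ R₂ (fun z => f k z.1 * g l z.2) Y τ‖ ≤
      C * (ρ ^ k * ρ ^ l) * ‖Y‖ := fun k l =>
    hC (f k) (g l) _ _ (by positivity) (by positivity) (fun z _ => hpow z₀.1 z k)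
      fun z _ => hpow z₀.2 z l
  have hadm : ∀ k l, Admissible R₁ R₂ fun z => f k z.1 * g l z.2 := fun k l =>
    Admissible.tensor
      ((SpectralDecomposition.Integrable.indicator measurableSet_ball).mul
        ((SpectralDecomposition.Integrable.id.sub (.const _)).pow k))
      ((SpectralDecomposition.Integrable.indicator measurableSet_ball).mul
        ((SpectralDecomposition.Integrable.id.sub (.const _)).pow l)) (hfg k l)
  refine ⟨A ×ˢ B, prod_mem_nhds (Metric.ball_mem_nhds _ hρ0) (Metric.ball_mem_nhds _ hρ0), ?_, ?_⟩
  · convert hadm 0 0 using 1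
    ext z
    by_cases h1 : z.1 ∈ A <;> by_cases h2 : z.2 ∈ B <;> simp [f, g, h1, h2]
  let Φ : ℕ → ℂ × ℂ → ℂ := fun n => ∑ s : Finset (Fin n),
    p n (s.piecewise (fun _ => (1, 0)) fun _ => (0, 1)) •
      fun z : ℂ × ℂ => f s.card z.1 * g (n - s.card) z.2
  have hΦ : ∀ n z, Φ n z = (A ×ˢ B).indicator (fun z => p n fun _ => z - z₀) z := by
    intro n z
    simp only [Φ, Finset.sum_apply, Pi.smul_apply, smul_eq_mul]
    by_cases hz : z ∈ A ×ˢ B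
    · rw [Set.indicator_of_mem hz]
      refine Eq.trans ?_ (multilinear_apply_prod n (p n) (z.1 - z₀.1) (z.2 - z₀.2)).symm
      simp [f, g, hz.1, hz.2]
    · rw [Set.indicator_of_notMem hz]
      refine Finset.sum_eq_zero fun s _ => ?_
      have : z.1 ∉ A ∨ z.2 ∉ B := by
        by_contra! h
        exact hz h
      rcases this with h | h <;> simp [f, g, h]
  refine Admissible.of_hasSum (φ := Φ) (c := fun n => C * (‖p n‖ * (q : ℝ) ^ n)) ?_ ?_ ?_ ?_
  · exact (p.summable_norm_mul_pow (hqr.trans_le hp.r_le)).mul_left C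
  · exact fun n => Admissible.sum fun s _ => (hadm _ _).smul _
  · intro n τ Y
    rw [dsum_sum]
    have hs : ∀ s : Finset (Fin n), ‖dsum R₁ R₂
        (p n (s.piecewise (fun _ => (1, 0)) fun _ => (0, 1)) •
          fun z : ℂ × ℂ => f s.card z.1 * g (n - s.card) z.2) Y τ‖ ≤
        ‖p n‖ * (C * ρ ^ n * ‖Y‖) := by
      intro s
      have hcard : s.card ≤ n := by simpa using s.card_le_univ
      have h1 := hfg s.card (n - s.card) τ Y
      rw [← pow_add, Nat.add_sub_cancel' hcard] at h1
      rw [dsum_smul, norm_smul]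
      exact mul_le_mul (norm_multilinear_piecewise_le n (p n) s) h1 (norm_nonneg _)
        (norm_nonneg _)
    refine (norm_sum_le_of_le _ fun s _ => hs s).trans_eq ?_
    -- there are `2 ^ n` monomials of degree `n`, counted with multiplicity, and `2 ρ = q`
    rw [Finset.sum_const, Finset.card_univ, Fintype.card_finset, Fintype.card_fin, nsmul_eq_mul,
      hρ, div_pow]
    push_cast
    field_simp
  · intro z
    simp only [hΦ]
    by_cases hz : z ∈ A ×ˢ B
    · simp only [Set.indicator_of_mem hz]
      refine hp.hasSum_sub ?_
      refine Metric.eball_subset_eball hqr.le ?_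
      rw [Metric.eball_coe, Metric.mem_ball, Prod.dist_eq, max_lt_iff]
      have h1 := Metric.mem_ball.1 hz.1
      have h2 := Metric.mem_ball.1 hz.2
      constructor <;> linarith
    · simp only [Set.indicator_of_notMem hz]
      exact hasSum_zero

/-- A function analytic in a neighbourhood of `σ(X₁) × σ(X₂)` is admissible: finitely many of the
local expansions cover the compact product, and they are patched by indicator functions. -/
theorem Admissible.of_analytic {φ : ℂ × ℂ → ℂ}
    (h : ∀ z ∈ spectrum ℂ X₁ ×ˢ spectrum ℂ X₂, AnalyticAt ℂ φ z) : Admissible R₁ R₂ φ := by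
  classical
  have hK : IsCompact (spectrum ℂ X₁ ×ˢ spectrum ℂ X₂) :=
    (spectrum.isCompact X₁).prod (spectrum.isCompact X₂)
  obtain ⟨B, hB, -, hφ⟩ := hK.induction_on (p := fun A => ∃ B : Set (ℂ × ℂ), A ⊆ B ∧
    Admissible R₁ R₂ (B.indicator 1) ∧ Admissible R₁ R₂ (B.indicator φ))
    ⟨∅, subset_rfl, by rw [Set.indicator_empty]; exact zero,
      by rw [Set.indicator_empty]; exact zero⟩
    (fun s t hst ⟨B, h1, h2⟩ => ⟨B, hst.trans h1, h2⟩)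
    (by
      rintro s t ⟨B, h1, h2, h3⟩ ⟨B', h1', h2', h3'⟩
      have key : ∀ f : ℂ × ℂ → ℂ, (B ∪ B').indicator f =
          B.indicator f + B'.indicator f - B.indicator 1 * B'.indicator f := by
        intro f
        ext z
        by_cases hz : z ∈ B <;> by_cases hz' : z ∈ B' <;> simp [hz, hz']
      refine ⟨B ∪ B', Set.union_subset_union h1 h1', ?_, ?_⟩
      · rw [key]
        exact (h2.add h2').sub (h2.mul h2')
      · rw [key]
        exact (h3.add h3').sub (h2.mul h3'))
    (fun z hz => by
      obtain ⟨U, hU, h1, h2⟩ := Admissible.exists_local (R₁ := R₁) (R₂ := R₂) (h z hz)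
      exact ⟨U, mem_nhdsWithin_of_mem_nhds hU, U, subset_rfl, h1, h2⟩)
  exact hφ.congr fun z hz => Set.indicator_of_mem (hB hz) φ

end GDOI

namespace GDOI

open Finset.HasAntidiagonal (antidiagonal mem_antidiagonal)

/-! ### Taylor coefficients of functions of two variables -/

/-- The Taylor coefficient `∂₂^k β / k!`. -/
noncomputable def taylorSnd (k : ℕ) (β : ℂ × ℂ → ℂ) (z : ℂ × ℂ) : ℂ :=
  iteratedDeriv k (fun w => β (z.1, w)) z.2 / k.factorial

/-- The Taylor coefficient `∂₁^n β / n!`. -/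
noncomputable def taylorFst (n : ℕ) (β : ℂ × ℂ → ℂ) (z : ℂ × ℂ) : ℂ :=
  taylorSnd n (β ∘ Prod.swap) z.swap

/-- The Taylor coefficient `β^{(a,b)} / (a! b!)`. -/
noncomputable def taylorCoeff (a b : ℕ) (β : ℂ × ℂ → ℂ) : ℂ × ℂ → ℂ :=
  taylorFst a (taylorSnd b β)

theorem taylorCoeff_apply (a b : ℕ) (β : ℂ × ℂ → ℂ) (s t : ℂ) :
    taylorCoeff a b β (s, t) = pderiv a b β s t / ((a.factorial : ℂ) * (b.factorial : ℂ)) := by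
  simp only [taylorCoeff, taylorFst, taylorSnd, Function.comp_def, Prod.swap, pderiv,
    div_eq_inv_mul (b := (b.factorial : ℂ)), iteratedDeriv_const_mul_field]
  field_simp

section Taylor

variable {D : Set (ℂ × ℂ)} {β γ : ℂ × ℂ → ℂ}

theorem analyticAt_slice_snd {z : ℂ × ℂ} (h : AnalyticAt ℂ β z) :
    AnalyticAt ℂ (fun w => β (z.1, w)) z.2 :=
  AnalyticAt.fun_comp (g := β) (f := fun w => (z.1, w)) h (analyticAt_const.prod analyticAt_id)

theorem analyticOnNhd_swap (h : AnalyticOnNhd ℂ β D) :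
    AnalyticOnNhd ℂ (β ∘ Prod.swap) (Prod.swap ⁻¹' D) := fun _ hz =>
  AnalyticAt.fun_comp (g := β) (f := Prod.swap) (h _ hz) (analyticAt_snd.prod analyticAt_fst)

theorem analyticOnNhd_iteratedDeriv_snd (hD : IsOpen D) (h : AnalyticOnNhd ℂ β D) (k : ℕ) :
    AnalyticOnNhd ℂ (fun z : ℂ × ℂ => iteratedDeriv k (fun w => β (z.1, w)) z.2) D := by
  induction k with
  | zero => simpa using h
  | succ k ih =>
    have h1 : AnalyticOnNhd ℂ (fun z => fderiv ℂ
        (fun z : ℂ × ℂ => iteratedDeriv k (fun w => β (z.1, w)) z.2) z (0, 1)) D :=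
      (ContinuousLinearMap.apply ℂ ℂ ((0, 1) : ℂ × ℂ)).comp_analyticOnNhd ih.fderiv
    refine h1.congr hD fun z hz => ?_
    have h2 : HasDerivAt (fun w : ℂ => (z.1, w)) ((0 : ℂ), (1 : ℂ)) z.2 :=
      (hasDerivAt_const _ _).prodMk (hasDerivAt_id _)
    have h3 := (ih z hz).differentiableAt.hasFDerivAt.comp_hasDerivAt z.2 h2
    simp only [iteratedDeriv_succ]
    exact h3.deriv.symm

theorem analyticOnNhd_taylorSnd (hD : IsOpen D) (h : AnalyticOnNhd ℂ β D) (k : ℕ) :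
    AnalyticOnNhd ℂ (taylorSnd k β) D := fun z hz =>
  ((analyticOnNhd_iteratedDeriv_snd hD h k z hz).div analyticAt_const
    (Nat.cast_ne_zero.2 k.factorial_ne_zero))

theorem analyticOnNhd_taylorFst (hD : IsOpen D) (h : AnalyticOnNhd ℂ β D) (n : ℕ) :
    AnalyticOnNhd ℂ (taylorFst n β) D :=
  analyticOnNhd_swap
    (analyticOnNhd_taylorSnd (hD.preimage continuous_swap) (analyticOnNhd_swap h) n)

theorem analyticOnNhd_taylorCoeff (hD : IsOpen D) (h : AnalyticOnNhd ℂ β D) (a b : ℕ) :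
    AnalyticOnNhd ℂ (taylorCoeff a b β) D :=
  analyticOnNhd_taylorFst hD (analyticOnNhd_taylorSnd hD h b) a

theorem taylorSnd_congr (hD : IsOpen D) (h : Set.EqOn β γ D) (k : ℕ) :
    Set.EqOn (taylorSnd k β) (taylorSnd k γ) D := by
  intro z hz
  have h1 : (fun w => β (z.1, w)) =ᶠ[𝓝 z.2] fun w => γ (z.1, w) := by
    have h2 : ∀ᶠ w in 𝓝 z.2, (z.1, w) ∈ D :=
      (by fun_prop : Continuous fun w : ℂ => (z.1, w)).continuousAt.eventually (hD.mem_nhds hz)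
    filter_upwards [h2] with w hw using h hw
  simp only [taylorSnd]
  rw [h1.iteratedDeriv_eq]

theorem taylorFst_congr (hD : IsOpen D) (h : Set.EqOn β γ D) (n : ℕ) :
    Set.EqOn (taylorFst n β) (taylorFst n γ) D := fun _ hz =>
  taylorSnd_congr (hD.preimage continuous_swap) (β := β ∘ Prod.swap) (γ := γ ∘ Prod.swap)
    (fun _ hw => h hw) n hz

theorem taylorSnd_sum {ι : Type*} {s : Finset ι} {β : ι → ℂ × ℂ → ℂ}
    (h : ∀ i ∈ s, AnalyticOnNhd ℂ (β i) D) (k : ℕ) :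
    Set.EqOn (taylorSnd k (∑ i ∈ s, β i)) (∑ i ∈ s, taylorSnd k (β i)) D := by
  intro z hz
  simp only [taylorSnd, Finset.sum_apply]
  rw [iteratedDeriv_fun_sum fun i hi => (analyticAt_slice_snd (h i hi z hz)).contDiffAt,
    Finset.sum_div]

theorem taylorFst_sum {ι : Type*} {s : Finset ι} {β : ι → ℂ × ℂ → ℂ}
    (h : ∀ i ∈ s, AnalyticOnNhd ℂ (β i) D) (n : ℕ) :
    Set.EqOn (taylorFst n (∑ i ∈ s, β i)) (∑ i ∈ s, taylorFst n (β i)) D := by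
  intro z hz
  have h1 : (∑ i ∈ s, β i) ∘ Prod.swap = ∑ i ∈ s, β i ∘ Prod.swap := by
    ext; simp
  simpa [taylorFst, h1] using
    taylorSnd_sum (fun i hi => analyticOnNhd_swap (h i hi)) n
      (show z.swap ∈ Prod.swap ⁻¹' D from hz)

theorem taylorSnd_const_mul (c : ℂ) (k : ℕ) : taylorSnd k (c • β) = c • taylorSnd k β := by
  ext z
  simp [taylorSnd, iteratedDeriv_const_mul_field, mul_div_assoc]

theorem taylorCoeff_smul (c : ℂ) (a b : ℕ) : taylorCoeff a b (c • β) = c • taylorCoeff a b β := by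
  ext z
  have h : (c • taylorSnd b β) ∘ Prod.swap = c • (taylorSnd b β ∘ Prod.swap) := rfl
  simp only [taylorCoeff, taylorFst, taylorSnd_const_mul, h, Pi.smul_apply]

theorem taylorCoeff_add (hD : IsOpen D) (hβ : AnalyticOnNhd ℂ β D) (hγ : AnalyticOnNhd ℂ γ D)
    (a b : ℕ) : Set.EqOn (taylorCoeff a b (β + γ)) (taylorCoeff a b β + taylorCoeff a b γ) D := by
  have h1 := taylorSnd_sum (s := Finset.univ) (β := ![β, γ]) (D := D)
    (fun i _ => by fin_cases i <;> assumption) b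
  have h2 := taylorFst_sum (s := Finset.univ) (β := ![taylorSnd b β, taylorSnd b γ]) (D := D)
    (fun i _ => by
      fin_cases i
      · exact analyticOnNhd_taylorSnd hD hβ b
      · exact analyticOnNhd_taylorSnd hD hγ b) a
  simp only [Fin.sum_univ_two, Matrix.cons_val_zero, Matrix.cons_val_one] at h1 h2
  exact (taylorFst_congr hD h1 a).trans h2

theorem taylorSnd_mul (hβ : AnalyticOnNhd ℂ β D) (hγ : AnalyticOnNhd ℂ γ D) (k : ℕ) :
    Set.EqOn (taylorSnd k (β * γ))
      (∑ q ∈ antidiagonal k, taylorSnd q.1 β * taylorSnd q.2 γ) D := by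
  intro z hz
  simp only [taylorSnd, Finset.sum_apply, Pi.mul_apply]
  rw [iteratedDeriv_fun_mul (analyticAt_slice_snd (hβ z hz)).contDiffAt
    (analyticAt_slice_snd (hγ z hz)).contDiffAt,
    Finset.Nat.sum_antidiagonal_eq_sum_range_succ_mk, Finset.sum_div]
  refine Finset.sum_congr rfl fun i hi => ?_
  have hik : i ≤ k := Nat.lt_succ_iff.1 (Finset.mem_range.1 hi)
  have h1 : (k.factorial : ℂ) = k.choose i * i.factorial * (k - i).factorial := by
    exact_mod_cast (Nat.choose_mul_factorial_mul_factorial hik).symm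
  have h2 : (k.choose i : ℂ) ≠ 0 := by exact_mod_cast (Nat.choose_pos hik).ne'
  rw [h1]
  field_simp

theorem taylorFst_mul (hβ : AnalyticOnNhd ℂ β D) (hγ : AnalyticOnNhd ℂ γ D) (n : ℕ) :
    Set.EqOn (taylorFst n (β * γ))
      (∑ p ∈ antidiagonal n, taylorFst p.1 β * taylorFst p.2 γ) D := by
  intro z hz
  have h := taylorSnd_mul (analyticOnNhd_swap hβ) (analyticOnNhd_swap hγ) n
    (show z.swap ∈ Prod.swap ⁻¹' D from hz)
  rw [Finset.sum_apply] at h ⊢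
  exact h

/-- The Leibniz rule for Taylor coefficients. -/
theorem taylorCoeff_mul (hD : IsOpen D) (hβ : AnalyticOnNhd ℂ β D) (hγ : AnalyticOnNhd ℂ γ D)
    (n k : ℕ) : Set.EqOn (taylorCoeff n k (β * γ))
      (∑ p ∈ antidiagonal n, ∑ q ∈ antidiagonal k,
        taylorCoeff p.1 q.1 β * taylorCoeff p.2 q.2 γ) D := by
  have h1 := taylorFst_congr hD (taylorSnd_mul hβ hγ k) n
  have h2 := taylorFst_sum (s := antidiagonal k)
    (β := fun q => taylorSnd q.1 β * taylorSnd q.2 γ) (D := D)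
    (fun q _ => (analyticOnNhd_taylorSnd hD hβ q.1).mul (analyticOnNhd_taylorSnd hD hγ q.2)) n
  refine (h1.trans h2).trans fun z hz => ?_
  rw [Finset.sum_comm, Finset.sum_apply, Finset.sum_apply]
  exact Finset.sum_congr rfl fun q _ => taylorFst_mul (analyticOnNhd_taylorSnd hD hβ q.1)
    (analyticOnNhd_taylorSnd hD hγ q.2) n hz

end Taylor

/-! ### Limits of double Riemann sums -/

variable {H : Type*} [NormedAddCommGroup H] [InnerProductSpace ℂ H] [CompleteSpace H]
  {X₁ X₂ : H →L[ℂ] H} (R₁ : SpectralDecomposition X₁) (R₂ : SpectralDecomposition X₂)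

/-- The value of `∫∫ φ(λ₁,λ₂) dE₁(λ₁) Y dE₂(λ₂)`, for admissible `φ`. -/
noncomputable def dlim (φ : ℂ × ℂ → ℂ) (Y : H →L[ℂ] H) : H →L[ℂ] H :=
  limUnder (refinement (spec X₁) ×ˢ refinement (spec X₂)) (dsum R₁ R₂ φ Y)

variable {R₁ R₂}

namespace Admissible

variable {φ ψ : ℂ × ℂ → ℂ}

theorem tendsto_dlim (hφ : Admissible R₁ R₂ φ) (Y : H →L[ℂ] H) :
    Tendsto (dsum R₁ R₂ φ Y) (refinement (spec X₁) ×ˢ refinement (spec X₂))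
      (𝓝 (dlim R₁ R₂ φ Y)) :=
  tendsto_nhds_limUnder (hφ.tendsto Y)

theorem dlim_add (hφ : Admissible R₁ R₂ φ) (hψ : Admissible R₁ R₂ ψ) (Y : H →L[ℂ] H) :
    dlim R₁ R₂ (φ + ψ) Y = dlim R₁ R₂ φ Y + dlim R₁ R₂ ψ Y :=
  tendsto_nhds_unique ((hφ.add hψ).tendsto_dlim Y)
    (((hφ.tendsto_dlim Y).add (hψ.tendsto_dlim Y)).congr fun _ => (dsum_add φ ψ Y).symm)

theorem dlim_smul (hφ : Admissible R₁ R₂ φ) (c : ℂ) (Y : H →L[ℂ] H) :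
    dlim R₁ R₂ (c • φ) Y = c • dlim R₁ R₂ φ Y :=
  tendsto_nhds_unique ((hφ.smul c).tendsto_dlim Y)
    (((hφ.tendsto_dlim Y).const_smul c).congr fun _ => (dsum_smul c φ Y).symm)

theorem dlim_sum {ι : Type*} {s : Finset ι} {φ : ι → ℂ × ℂ → ℂ}
    (h : ∀ i ∈ s, Admissible R₁ R₂ (φ i)) (Y : H →L[ℂ] H) :
    dlim R₁ R₂ (∑ i ∈ s, φ i) Y = ∑ i ∈ s, dlim R₁ R₂ (φ i) Y :=
  tendsto_nhds_unique ((Admissible.sum h).tendsto_dlim Y)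
    ((tendsto_finsetSum s fun i hi => (h i hi).tendsto_dlim Y).congr fun _ =>
      (dsum_sum s φ Y).symm)

theorem dlim_add_right (hφ : Admissible R₁ R₂ φ) (Y Z : H →L[ℂ] H) :
    dlim R₁ R₂ φ (Y + Z) = dlim R₁ R₂ φ Y + dlim R₁ R₂ φ Z :=
  tendsto_nhds_unique (hφ.tendsto_dlim _)
    (((hφ.tendsto_dlim Y).add (hφ.tendsto_dlim Z)).congr fun _ => (dsum_add_right φ Y Z).symm)

theorem dlim_zero_right (hφ : Admissible R₁ R₂ φ) : dlim R₁ R₂ φ 0 = 0 := by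
  have := hφ.dlim_add_right 0 0
  rwa [add_zero, left_eq_add] at this

theorem dlim_sum_right (hφ : Admissible R₁ R₂ φ) {ι : Type*} (s : Finset ι)
    (Y : ι → H →L[ℂ] H) : dlim R₁ R₂ φ (∑ i ∈ s, Y i) = ∑ i ∈ s, dlim R₁ R₂ φ (Y i) := by
  classical
  induction s using Finset.induction_on with
  | empty => simpa using hφ.dlim_zero_right
  | insert i s hi ih => rw [Finset.sum_insert hi, Finset.sum_insert hi, dlim_add_right hφ, ih]

theorem dlim_mul (hφ : Admissible R₁ R₂ φ) (hψ : Admissible R₁ R₂ ψ) (Y : H →L[ℂ] H) :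
    dlim R₁ R₂ (φ * ψ) Y = dlim R₁ R₂ φ (dlim R₁ R₂ ψ Y) :=
  tendsto_nhds_unique ((hφ.mul hψ).tendsto_dlim Y)
    ((hφ.tendsto_dsum (hψ.tendsto_dlim Y) (hφ.tendsto_dlim _)).congr fun _ => dsum_dsum φ ψ Y)

/-- The limits of `powSum` commute with the spectral measures, hence with the integral. -/
theorem dlim_pow_mul_pow (hφ : Admissible R₁ R₂ φ) {a b : ℕ} {P Q : H →L[ℂ] H}
    (hP : Tendsto (R₁.powSum a) (refinement (spec X₁)) (𝓝 P))
    (hQ : Tendsto (R₂.powSum b) (refinement (spec X₂)) (𝓝 Q)) (Y : H →L[ℂ] H) :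
    dlim R₁ R₂ φ (P * Y * Q) = P * dlim R₁ R₂ φ Y * Q := by
  have hP' := hP.comp (tendsto_fst (f := refinement (spec X₁)) (g := refinement (spec X₂)))
  have hQ' := hQ.comp (tendsto_snd (f := refinement (spec X₁)) (g := refinement (spec X₂)))
  refine tendsto_nhds_unique (hφ.tendsto_dsum ((hP'.mul_const Y).mul hQ') (hφ.tendsto_dlim _))
    (((hP'.mul (hφ.tendsto_dlim Y)).mul hQ').congr fun τ => ?_)
  simp only [Function.comp_apply, dsum, Finset.mul_sum, Finset.sum_mul]
  refine Finset.sum_congr rfl fun Δ₁ _ => Finset.sum_congr rfl fun Δ₂ _ => ?_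
  have h1 : Commute (R₁.powSum a τ.1) (R₁.E Δ₁.1) :=
    SpectralDecomposition.commute_rsum_E _ (R₁.commute_ite_pow_E a) Δ₁.2
  have h2 : Commute (R₂.powSum b τ.2) (R₂.E Δ₂.1) :=
    SpectralDecomposition.commute_rsum_E _ (R₂.commute_ite_pow_E b) Δ₂.2
  rw [mul_smul_comm, smul_mul_assoc]
  congr 1
  calc R₁.powSum a τ.1 * (R₁.E Δ₁.1 * Y * R₂.E Δ₂.1) * R₂.powSum b τ.2
      = (R₁.powSum a τ.1 * R₁.E Δ₁.1) * Y * (R₂.E Δ₂.1 * R₂.powSum b τ.2) := by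
        simp only [mul_assoc]
    _ = R₁.E Δ₁.1 * (R₁.powSum a τ.1 * Y * R₂.powSum b τ.2) * R₂.E Δ₂.1 := by
        rw [h1.eq, ← h2.eq]
        simp only [mul_assoc]

end Admissible

theorem dlim_congr {φ ψ : ℂ × ℂ → ℂ}
    (h : ∀ z ∈ spectrum ℂ X₁ ×ˢ spectrum ℂ X₂, φ z = ψ z) (Y : H →L[ℂ] H) :
    dlim R₁ R₂ φ Y = dlim R₁ R₂ ψ Y := by
  have h' : dsum R₁ R₂ φ Y = dsum R₁ R₂ ψ Y := funext fun τ => dsum_congr h Y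
  rw [dlim, dlim, h']

/-! ### The generalized double operator integral -/

/-- The part of the Riemann sums of the generalized double operator integral that involves the
derivatives `β^{(a,b)}` with `a ∈ A` and `b ∈ B`. -/
noncomputable def blockSum (R₁ : SpectralDecomposition X₁) (R₂ : SpectralDecomposition X₂)
    (A B : Finset ℕ) (β : ℂ × ℂ → ℂ) (Y : H →L[ℂ] H)
    (τ : TaggedPartition (spec X₁) × TaggedPartition (spec X₂)) : H →L[ℂ] H :=
  ∑ a ∈ A, ∑ b ∈ B, dsum R₁ R₂ (taylorCoeff a b β) (R₁.powSum a τ.1 * Y * R₂.powSum b τ.2) τ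

theorem blockSum_eq (A B : Finset ℕ) (β : ℂ × ℂ → ℂ) (Y : H →L[ℂ] H)
    (τ : TaggedPartition (spec X₁) × TaggedPartition (spec X₂)) :
    blockSum R₁ R₂ A B β Y τ = ∑ Δ₁ ∈ τ.1.cells.parts, ∑ Δ₂ ∈ τ.2.cells.parts,
      ∑ a ∈ A with a = 0 ∨ a < R₁.m (τ.1.tag Δ₁), ∑ b ∈ B with b = 0 ∨ b < R₂.m (τ.2.tag Δ₂),
        taylorCoeff a b β (τ.1.tag Δ₁, τ.2.tag Δ₂) •
          ((X₁ - τ.1.tag Δ₁ • (1 : H →L[ℂ] H)) ^ a * R₁.E Δ₁.1 * Y *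
            ((X₂ - τ.2.tag Δ₂ • (1 : H →L[ℂ] H)) ^ b * R₂.E Δ₂.1)) := by
  have h : ∀ a b, dsum R₁ R₂ (taylorCoeff a b β) (R₁.powSum a τ.1 * Y * R₂.powSum b τ.2) τ = _ :=
    fun a b => dsum_rsum_mul_rsum (R₁.commute_ite_pow_E a) _ Y
  simp only [blockSum, h, Finset.sum_filter]
  -- bring the sums over cells outside the sums over the orders `a` and `b`
  rw [Finset.sum_congr rfl fun a _ => Finset.sum_comm, Finset.sum_comm]
  refine Finset.sum_congr rfl fun Δ₁ _ => ?_
  rw [Finset.sum_congr rfl fun a _ => Finset.sum_comm, Finset.sum_comm]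
  refine Finset.sum_congr rfl fun Δ₂ _ => Finset.sum_congr rfl fun a _ => ?_
  split_ifs
  · refine Finset.sum_congr rfl fun b _ => ?_
    split_ifs <;> simp
  · simp

theorem filter_Icc_lt {m M : ℕ} (h : m ≤ M) :
    (Finset.Icc 1 M).filter (fun a => a = 0 ∨ a < m) = Finset.Icc 1 (m - 1) := by
  ext a
  simp only [Finset.mem_filter, Finset.mem_Icc]
  omega

section Kernels

variable {M : ℕ} (β : ℂ × ℂ → ℂ) (Y : H →L[ℂ] H)

theorem doubleSum_kernelPP : doubleSum R₁.E R₂.E (spec X₁) (spec X₂) (kernelPP β Y) =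
    blockSum R₁ R₂ {0} {0} β Y := by
  ext1 τ
  rw [blockSum_eq]
  simp [doubleSum, kernelPP, Finset.filter_singleton, taylorCoeff_apply, pderiv]

theorem doubleSum_kernelPN (h₂ : ∀ z ∈ spectrum ℂ X₂, R₂.m z ≤ M) :
    doubleSum R₁.E R₂.E (spec X₁) (spec X₂) (kernelPN R₂ β Y) =
      blockSum R₁ R₂ {0} (Finset.Icc 1 M) β Y := by
  ext1 τ
  rw [blockSum_eq]
  refine Finset.sum_congr rfl fun Δ₁ _ => Finset.sum_congr rfl fun Δ₂ hΔ₂ => ?_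
  rw [filter_Icc_lt (h₂ _ (τ.2.tag_mem_base hΔ₂))]
  simp [kernelPN, Finset.filter_singleton, taylorCoeff_apply]

theorem doubleSum_kernelNP (h₁ : ∀ z ∈ spectrum ℂ X₁, R₁.m z ≤ M) :
    doubleSum R₁.E R₂.E (spec X₁) (spec X₂) (kernelNP R₁ β Y) =
      blockSum R₁ R₂ (Finset.Icc 1 M) {0} β Y := by
  ext1 τ
  rw [blockSum_eq]
  refine Finset.sum_congr rfl fun Δ₁ hΔ₁ => Finset.sum_congr rfl fun Δ₂ _ => ?_
  rw [filter_Icc_lt (h₁ _ (τ.1.tag_mem_base hΔ₁))]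
  simp [kernelNP, Finset.filter_singleton, taylorCoeff_apply]

theorem doubleSum_kernelNN (h₁ : ∀ z ∈ spectrum ℂ X₁, R₁.m z ≤ M)
    (h₂ : ∀ z ∈ spectrum ℂ X₂, R₂.m z ≤ M) :
    doubleSum R₁.E R₂.E (spec X₁) (spec X₂) (kernelNN R₁ R₂ β Y) =
      blockSum R₁ R₂ (Finset.Icc 1 M) (Finset.Icc 1 M) β Y := by
  ext1 τ
  rw [blockSum_eq]
  refine Finset.sum_congr rfl fun Δ₁ hΔ₁ => Finset.sum_congr rfl fun Δ₂ hΔ₂ => ?_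
  rw [filter_Icc_lt (h₁ _ (τ.1.tag_mem_base hΔ₁)), filter_Icc_lt (h₂ _ (τ.2.tag_mem_base hΔ₂))]
  simp [kernelNN, taylorCoeff_apply]

end Kernels

/-- A truncated double sum, rearranged along antidiagonals. -/
theorem sum_range_range_eq_sum_antidiagonal {V : Type*} [AddCommMonoid V] (K : ℕ) (g : ℕ → ℕ → V)
    (hg : ∀ a c, K ≤ a + c → g a c = 0) :
    ∑ a ∈ Finset.range K, ∑ c ∈ Finset.range K, g a c =
      ∑ n ∈ Finset.range K, ∑ p ∈ antidiagonal n, g p.1 p.2 := by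
  simp only [Finset.Nat.sum_antidiagonal_eq_sum_range_succ g]
  rw [Finset.sum_range_diag_flip]
  refine Finset.sum_congr rfl fun a _ => (Finset.sum_subset ?_ ?_).symm
  · exact Finset.range_mono (Nat.sub_le _ _)
  · intro c _ hc
    refine hg a c ?_
    rw [Finset.mem_range] at hc
    omega

section Homomorphism

variable {N₁ N₂ : H →L[ℂ] H} {D : Set (ℂ × ℂ)} {M : ℕ} {β γ : ℂ × ℂ → ℂ}
  (hN₁ : ∀ a, Tendsto (R₁.powSum a) (refinement (spec X₁)) (𝓝 (N₁ ^ a)))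
  (hN₂ : ∀ b, Tendsto (R₂.powSum b) (refinement (spec X₂)) (𝓝 (N₂ ^ b)))
  (h₁ : ∀ z ∈ spectrum ℂ X₁, R₁.m z ≤ M) (h₂ : ∀ z ∈ spectrum ℂ X₂, R₂.m z ≤ M)
  (hD : IsOpen D) (hspec : spectrum ℂ X₁ ×ˢ spectrum ℂ X₂ ⊆ D)

theorem admissible_taylorCoeff (hD : IsOpen D) (hspec : spectrum ℂ X₁ ×ˢ spectrum ℂ X₂ ⊆ D)
    (hβ : AnalyticOnNhd ℂ β D) (a b : ℕ) : Admissible R₁ R₂ (taylorCoeff a b β) :=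
  Admissible.of_analytic fun z hz => analyticOnNhd_taylorCoeff hD hβ a b z (hspec hz)

include hN₁ hN₂ hD hspec

theorem tendsto_blockSum (hβ : AnalyticOnNhd ℂ β D) (A B : Finset ℕ) (Y : H →L[ℂ] H) :
    Tendsto (blockSum R₁ R₂ A B β Y) (refinement (spec X₁) ×ˢ refinement (spec X₂))
      (𝓝 (∑ a ∈ A, ∑ b ∈ B, dlim R₁ R₂ (taylorCoeff a b β) (N₁ ^ a * Y * N₂ ^ b))) :=
  tendsto_finsetSum _ fun a _ => tendsto_finsetSum _ fun b _ =>
    (admissible_taylorCoeff hD hspec hβ a b).tendsto_dsum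
      ((((hN₁ a).comp tendsto_fst).mul_const Y).mul ((hN₂ b).comp tendsto_snd))
      ((admissible_taylorCoeff hD hspec hβ a b).tendsto_dlim _)

include h₁ h₂

theorem converges (hβ : AnalyticOnNhd ℂ β D) (Y : H →L[ℂ] H) : Converges R₁ R₂ β Y := by
  simp only [Converges, HasDoubleIntegral, doubleSum_kernelPP, doubleSum_kernelPN β Y h₂,
    doubleSum_kernelNP β Y h₁, doubleSum_kernelNN β Y h₁ h₂]
  exact ⟨⟨_, tendsto_blockSum hN₁ hN₂ hD hspec hβ _ _ Y⟩,
    ⟨_, tendsto_blockSum hN₁ hN₂ hD hspec hβ _ _ Y⟩,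
    ⟨_, tendsto_blockSum hN₁ hN₂ hD hspec hβ _ _ Y⟩,
    ⟨_, tendsto_blockSum hN₁ hN₂ hD hspec hβ _ _ Y⟩⟩

/-- The generalized double operator integral is a Taylor polynomial in the nilpotent parts:
`T_β(Y) = ∑_{a,b} (1 / (a! b!)) ∫∫ β^{(a,b)} dE₁ (N₁^a Y N₂^b) dE₂`. -/
theorem gdoi_eq (hβ : AnalyticOnNhd ℂ β D) (Y : H →L[ℂ] H) :
    gdoi R₁ R₂ β Y = ∑ a ∈ Finset.range (M + 1), ∑ b ∈ Finset.range (M + 1),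
      dlim R₁ R₂ (taylorCoeff a b β) (N₁ ^ a * Y * N₂ ^ b) := by
  have hlim := fun A B => (tendsto_blockSum hN₁ hN₂ hD hspec hβ A B Y).limUnder_eq
  simp only [gdoi, doubleIntegral, doubleSum_kernelPP, doubleSum_kernelPN β Y h₂,
    doubleSum_kernelNP β Y h₁, doubleSum_kernelNN β Y h₁ h₂, hlim]
  -- the four integrals are the four blocks of orders `a = 0` or `a ≥ 1`, `b = 0` or `b ≥ 1`
  have hr : Finset.range (M + 1) = {0} ∪ Finset.Icc 1 M := by
    ext a
    simp only [Finset.mem_range, Finset.mem_union, Finset.mem_singleton, Finset.mem_Icc]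
    omega
  have hd : Disjoint {0} (Finset.Icc 1 M) := by simp
  simp only [hr, Finset.sum_union hd, Finset.sum_add_distrib]
  abel

theorem gdoi_linear (hβ : AnalyticOnNhd ℂ β D) (hγ : AnalyticOnNhd ℂ γ D) (c d : ℂ) :
    gdoi R₁ R₂ (c • β + d • γ) = c • gdoi R₁ R₂ β + d • gdoi R₁ R₂ γ := by
  have hcβ : AnalyticOnNhd ℂ (c • β) D := fun z hz => (hβ z hz).const_smul
  have hdγ : AnalyticOnNhd ℂ (d • γ) D := fun z hz => (hγ z hz).const_smul
  ext1 Y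
  rw [Pi.add_apply, Pi.smul_apply, Pi.smul_apply,
    gdoi_eq hN₁ hN₂ h₁ h₂ hD hspec (hcβ.add hdγ), gdoi_eq hN₁ hN₂ h₁ h₂ hD hspec hβ,
    gdoi_eq hN₁ hN₂ h₁ h₂ hD hspec hγ]
  simp only [Finset.smul_sum, ← Finset.sum_add_distrib]
  refine Finset.sum_congr rfl fun a _ => Finset.sum_congr rfl fun b _ => ?_
  have hb := admissible_taylorCoeff (R₁ := R₁) (R₂ := R₂) hD hspec hβ a b
  have hc := admissible_taylorCoeff (R₁ := R₁) (R₂ := R₂) hD hspec hγ a b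
  rw [dlim_congr fun z hz => taylorCoeff_add hD hcβ hdγ a b (hspec hz), taylorCoeff_smul,
    taylorCoeff_smul, (hb.smul c).dlim_add (hc.smul d), hb.dlim_smul, hc.dlim_smul]

/-- Multiplicativity is the product rule for truncated Taylor polynomials: the Leibniz rule matches
the terms below the truncation, and the others vanish because `N₁` and `N₂` are nilpotent. -/
theorem gdoi_mul (hM₁ : N₁ ^ M = 0) (hM₂ : N₂ ^ M = 0)
    (hβ : AnalyticOnNhd ℂ β D) (hγ : AnalyticOnNhd ℂ γ D) :
    gdoi R₁ R₂ (β * γ) = gdoi R₁ R₂ β ∘ gdoi R₁ R₂ γ := by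
  have hb := admissible_taylorCoeff (R₁ := R₁) (R₂ := R₂) hD hspec hβ
  have hc := admissible_taylorCoeff (R₁ := R₁) (R₂ := R₂) hD hspec hγ
  ext1 Y
  let G : ℕ → ℕ → ℕ → ℕ → H →L[ℂ] H := fun a c b d =>
    dlim R₁ R₂ (taylorCoeff a b β * taylorCoeff c d γ) (N₁ ^ (a + c) * Y * N₂ ^ (b + d))
  have hG₁ : ∀ a c b d, M + 1 ≤ a + c → G a c b d = 0 := by
    intro a c b d h
    simp only [G]
    rw [pow_eq_zero_of_le (by omega) hM₁, zero_mul, zero_mul]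
    exact ((hb a b).mul (hc c d)).dlim_zero_right
  have hG₂ : ∀ a c b d, M + 1 ≤ b + d → G a c b d = 0 := by
    intro a c b d h
    simp only [G]
    rw [pow_eq_zero_of_le (by omega) hM₂, mul_zero]
    exact ((hb a b).mul (hc c d)).dlim_zero_right
  have hcomp : ∀ a b, dlim R₁ R₂ (taylorCoeff a b β) (N₁ ^ a * gdoi R₁ R₂ γ Y * N₂ ^ b) =
      ∑ c ∈ Finset.range (M + 1), ∑ d ∈ Finset.range (M + 1), G a c b d := by
    intro a b
    rw [gdoi_eq hN₁ hN₂ h₁ h₂ hD hspec hγ]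
    simp only [Finset.mul_sum, Finset.sum_mul, (hb a b).dlim_sum_right]
    refine Finset.sum_congr rfl fun c _ => Finset.sum_congr rfl fun d _ => ?_
    simp only [G]
    rw [← (hc c d).dlim_pow_mul_pow (hN₁ a) (hN₂ b), ← (hb a b).dlim_mul (hc c d), pow_add,
      add_comm b d, pow_add]
    simp only [mul_assoc]
  have hprod : ∀ n k, dlim R₁ R₂ (taylorCoeff n k (β * γ)) (N₁ ^ n * Y * N₂ ^ k) =
      ∑ p ∈ antidiagonal n, ∑ q ∈ antidiagonal k, G p.1 p.2 q.1 q.2 := by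
    intro n k
    rw [dlim_congr fun z hz => taylorCoeff_mul hD hβ hγ n k (hspec hz),
      Admissible.dlim_sum fun p _ => Admissible.sum fun q _ => (hb _ _).mul (hc _ _)]
    refine Finset.sum_congr rfl fun p hp => ?_
    rw [Admissible.dlim_sum fun q _ => (hb _ _).mul (hc _ _)]
    refine Finset.sum_congr rfl fun q hq => ?_
    simp only [G]
    rw [mem_antidiagonal.1 hp, mem_antidiagonal.1 hq]
  rw [Function.comp_apply, gdoi_eq (β := β * γ) hN₁ hN₂ h₁ h₂ hD hspec (hβ.mul hγ),
    gdoi_eq hN₁ hN₂ h₁ h₂ hD hspec hβ (gdoi R₁ R₂ γ Y)]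
  simp only [hcomp, hprod]
  calc ∑ n ∈ Finset.range (M + 1), ∑ k ∈ Finset.range (M + 1),
        ∑ p ∈ antidiagonal n, ∑ q ∈ antidiagonal k, G p.1 p.2 q.1 q.2
      = ∑ n ∈ Finset.range (M + 1), ∑ p ∈ antidiagonal n,
          ∑ k ∈ Finset.range (M + 1), ∑ q ∈ antidiagonal k, G p.1 p.2 q.1 q.2 :=
        Finset.sum_congr rfl fun n _ => Finset.sum_comm
    _ = ∑ n ∈ Finset.range (M + 1), ∑ p ∈ antidiagonal n,
          ∑ b ∈ Finset.range (M + 1), ∑ d ∈ Finset.range (M + 1), G p.1 p.2 b d :=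
        Finset.sum_congr rfl fun n _ => Finset.sum_congr rfl fun p _ =>
          (sum_range_range_eq_sum_antidiagonal _ (G p.1 p.2) (hG₂ p.1 p.2)).symm
    _ = ∑ a ∈ Finset.range (M + 1), ∑ c ∈ Finset.range (M + 1),
          ∑ b ∈ Finset.range (M + 1), ∑ d ∈ Finset.range (M + 1), G a c b d :=
        (sum_range_range_eq_sum_antidiagonal _
          (fun a c => ∑ b ∈ Finset.range (M + 1), ∑ d ∈ Finset.range (M + 1), G a c b d)
          fun a c h => Finset.sum_eq_zero fun b _ => Finset.sum_eq_zero fun d _ =>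
            hG₁ a c b d h).symm
    _ = ∑ a ∈ Finset.range (M + 1), ∑ b ∈ Finset.range (M + 1),
          ∑ c ∈ Finset.range (M + 1), ∑ d ∈ Finset.range (M + 1), G a c b d :=
        Finset.sum_congr rfl fun a _ => Finset.sum_comm

end Homomorphism

end GDOI

theorem mainTheorem3 {H : Type*} [NormedAddCommGroup H] [InnerProductSpace ℂ H]
    [CompleteSpace H] (X₁ X₂ : H →L[ℂ] H)
    (R₁ : GDOI.SpectralDecomposition X₁) (R₂ : GDOI.SpectralDecomposition X₂)
    (D : Set (ℂ × ℂ)) (hD : IsOpen D) (hspec : spectrum ℂ X₁ ×ˢ spectrum ℂ X₂ ⊆ D) :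
    (∀ β : ℂ × ℂ → ℂ, AnalyticOnNhd ℂ β D →
      ∀ Y : H →L[ℂ] H, GDOI.Converges R₁ R₂ β Y) ∧
    (∀ (c₁ c₂ : ℂ) (β₁ β₂ : ℂ × ℂ → ℂ), AnalyticOnNhd ℂ β₁ D → AnalyticOnNhd ℂ β₂ D →
      GDOI.gdoi R₁ R₂ (c₁ • β₁ + c₂ • β₂) =
        c₁ • GDOI.gdoi R₁ R₂ β₁ + c₂ • GDOI.gdoi R₁ R₂ β₂) ∧
    (∀ β γ : ℂ × ℂ → ℂ, AnalyticOnNhd ℂ β D → AnalyticOnNhd ℂ γ D →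
      GDOI.gdoi R₁ R₂ (β * γ) = GDOI.gdoi R₁ R₂ β ∘ GDOI.gdoi R₁ R₂ γ) := by
  obtain ⟨M₁, hM₁⟩ := R₁.m_bounded
  obtain ⟨M₂, hM₂⟩ := R₂.m_bounded
  have h₁ : ∀ z ∈ spectrum ℂ X₁, R₁.m z ≤ max M₁ M₂ := fun z hz =>
    (hM₁ z hz).trans (le_max_left _ _)
  have h₂ : ∀ z ∈ spectrum ℂ X₂, R₂.m z ≤ max M₁ M₂ := fun z hz =>
    (hM₂ z hz).trans (le_max_right _ _)
  obtain ⟨N₁, hN₁, hnil₁⟩ := R₁.exists_nilpotentPart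
  obtain ⟨N₂, hN₂, hnil₂⟩ := R₂.exists_nilpotentPart
  exact ⟨fun β hβ Y => GDOI.converges hN₁ hN₂ h₁ h₂ hD hspec hβ Y,
    fun c₁ c₂ β₁ β₂ hβ₁ hβ₂ => GDOI.gdoi_linear hN₁ hN₂ h₁ h₂ hD hspec hβ₁ hβ₂ c₁ c₂,
    fun β γ hβ hγ => GDOI.gdoi_mul hN₁ hN₂ h₁ h₂ hD hspec (hnil₁ _ h₁) (hnil₂ _ h₂) hβ hγ⟩
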